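/- Let $(V,Q)$ be a non-degenerate, isotropic, finite-dimensional quadratic space over $\mathbb{Q}$, with bilinear form $Q(X,Y)=\frac12(Q(X+Y)-Q(X)-Q(Y))$. A $\mathbb{Z}$-lattice $M$ in a subspace $W$ of $V$ (spanning $W$ over $\mathbb{Q}$) is called maximal integral in $W$ if it is maximal among the $\mathbb{Z}$-lattices $M$ in $W$ with $\frac12Q(M)\subset\mathbb{Z}$; a vector $x$ of a lattice $M$ is primitive in $M$ if $x=ny$ with $n\in\mathbb{Z}$, $y\in M$ forces $n=\pm1$. Let $L$ be a maximal integral lattice in $V$, with dual lattice $L^*=\{X\in V: Q(X,L)\subset\mathbb{Z}\}$, and let $\xi\in L^*$ be reduced: $\xi$ is primitive in $L^*$ and, with $V^\xi=\{X\in V: Q(X,\xi)=0\}$, the lattice $L^\xi=L\cap V^\xi$ is maximal integral in $V^\xi$. Let $L^{\xi*}$ be the dual lattice of $L^\xi$ in $V^\xi$. Put $G=\mathrm{O}(Q)$ and $G^\xi=\mathrm{Stab}_G(\xi)$; a subscript $p$ on a lattice denotes $\otimes\,\mathbb{Z}_p$. For each prime $p$ set $$K_p=\{g\in G(\mathbb{Q}_p):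 gL_p=L_p\},\qquad K_p^*=\{g\in K_p: (g-1)L_p^*\subset L_p\},$$ $$K_p^{\xi*}=\{h\in G^\xi(\mathbb{Q}_p): hL^\xi_p=L^\xi_p,\ (h-1)L^{\xi*}_p\subset L^\xi_p\},$$ and $K_{\mathrm f}=\prod_pK_p$, $K_{\mathrm f}^{\xi*}=\prod_pK_p^{\xi*}$. Let $\mathbb{A}_{\mathrm f}$ be the ring of finite adeles of $\mathbb{Q}$. Assume $K_p=K_p^*$ for every prime $p$. Let $(u_j)_{j\in J}$ be a family of elements of $G(\mathbb{A}_{\mathrm f})$ such that $G(\mathbb{A}_{\mathrm f})=\bigsqcup_{j\in J}G(\mathbb{Q})u_jK_{\mathrm f}$. (Such a family exists and $J$ is finite, of cardinality the class number of $G$; this is not part of the claim.) For $u\in G(\mathbb{A}_{\mathrm f})$ let $$L(u)=V\cap\prod_pu_pL_p,\qquad \Gamma(u)=G(\mathbb{Q})\cap\prod_pu_pK_pu_p^{-1},$$ and for $\Delta\in\mathbb{Q}$ let $L(u)^*_{\mathrm{prim},[\Delta]}$ be the set of the primitive vectors $\eta$ of the dual lattice $L(u)^*$ with $Q(\eta)=\Delta$.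 Set $\Delta=Q(\xi)$. Then there exists a bijection $$\bar\jmath:\ G^\xi(\mathbb{Q})\backslash G^\xi(\mathbb{A}_{\mathrm f})/K_{\mathrm f}^{\xi*}\ \longrightarrow\ \bigsqcup_{j\in J}\Gamma(u_j)\backslash L(u_j)^*_{\mathrm{prim},[\Delta]}$$ such that, for every $h\in G^\xi(\mathbb{A}_{\mathrm f})$, every $j\in J$ and every $\eta\in L(u_j)^*_{\mathrm{prim},[\Delta]}$ whose $\Gamma(u_j)$-orbit is the image under $\bar\jmath$ of the double coset of $h$, $$\#\bigl(G^\xi(\mathbb{Q})\cap hK_{\mathrm f}^{\xi*}h^{-1}\bigr)=\#\{\gamma\in\Gamma(u_j):\gamma\eta=\eta\}$$ (equality of cardinalities, finite or infinite). -/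

import Mathlib

open scoped TensorProduct RestrictedProduct Pointwise

noncomputable section

namespace QuadLattice

section General

variable {R A E : Type*} [CommRing R] [CommRing A] [Algebra R A]
  [AddCommGroup E] [Module R E] [Module A E] [IsScalarTower R A E]

/-- The orthogonal group `O(Q)` of a quadratic form, as a group of linear automorphisms. -/
def orthogonal (Q : QuadraticForm A E) : Subgroup (E ≃ₗ[A] E) where
  carrier := {g | ∀ x, Q (g x) = Q x}
  mul_mem' {g h} hg hh x := by
    rw [LinearEquiv.mul_apply, hg, hh]
  one_mem' _ := rfl
  inv_mem' {g} hg x := by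
    have h := hg (g⁻¹ x)
    rw [← LinearEquiv.mul_apply, mul_inv_cancel] at h
    exact h.symm

/-- The stabilizer of a vector. -/
def fixing (x : E) : Subgroup (E ≃ₗ[A] E) where
  carrier := {g | g x = x}
  mul_mem' {g h} hg hh := by
    change g (h x) = x
    rw [show h x = x from hh]
    exact hg
  one_mem' := rfl
  inv_mem' {g} hg := by
    change g⁻¹ x = x
    nth_rewrite 1 [← (show g x = x from hg)]
    rw [← LinearEquiv.mul_apply, inv_mul_cancel]
    rfl

/-- The automorphisms `g` with `g M = M`. -/
def preserving (M : Submodule R E) : Subgroup (E ≃ₗ[A] E) where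
  carrier := {g | ∀ x, g x ∈ M ↔ x ∈ M}
  mul_mem' {g h} hg hh x := (hg (h x)).trans (hh x)
  one_mem' _ := Iff.rfl
  inv_mem' {g} hg x := by
    have h := hg (g⁻¹ x)
    rw [← LinearEquiv.mul_apply, mul_inv_cancel] at h
    exact h.symm

/-- The automorphisms `g` with `g M = M` and `(g - 1) N ⊆ M`; it is used for a lattice `M` and its
dual lattice `N`. -/
def discKernel (M N : Submodule R E) : Subgroup (E ≃ₗ[A] E) where
  carrier := {g | g ∈ preserving M ∧ ∀ x ∈ N, g x - x ∈ M}
  mul_mem' {g h} hg hh := by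
    refine ⟨mul_mem hg.1 hh.1, fun x hx => ?_⟩
    have h1 : g (h x - x) ∈ M := (hg.1 _).2 (hh.2 x hx)
    have h2 := add_mem h1 (hg.2 x hx)
    rw [map_sub] at h2
    simpa [LinearEquiv.mul_apply] using h2
  one_mem' := ⟨one_mem _, fun x _ => by simp⟩
  inv_mem' {g} hg := by
    refine ⟨inv_mem hg.1, fun x hx => ?_⟩
    have h1 : g⁻¹ (g x - x) ∈ M := ((inv_mem hg.1 : g⁻¹ ∈ preserving M) _).2 (hg.2 x hx)
    have h2 : g⁻¹ (g x) = x := by rw [← LinearEquiv.mul_apply, inv_mul_cancel]; rfl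
    rw [map_sub, h2] at h1
    simpa using neg_mem h1

end General

section Rational

variable {V : Type*} [AddCommGroup V] [Module ℚ V]

/-- `L` is a `ℤ`-lattice in the subspace `W` with `2⁻¹ Q(L) ⊆ ℤ`. -/
def IsIntegralIn (Q : QuadraticForm ℚ V) (W : Submodule ℚ V) (L : Submodule ℤ V) : Prop :=
  L.FG ∧ Submodule.span ℚ (L : Set V) = W ∧ ∀ x ∈ L, ∃ n : ℤ, Q x / 2 = n

/-- `L` is a maximal integral lattice in the quadratic space `(W, Q|W)`. -/
def IsMaximalIn (Q : QuadraticForm ℚ V) (W : Submodule ℚ V) (L : Submodule ℤ V) : Prop :=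
  IsIntegralIn Q W L ∧ ∀ M : Submodule ℤ V, IsIntegralIn Q W M → L ≤ M → M = L

/-- The dual lattice of a lattice `L` of the full space `V`, for the bilinear form
`(X, Y) ↦ (Q(X + Y) - Q(X) - Q(Y)) / 2`. -/
def dual (Q : QuadraticForm ℚ V) (L : Submodule ℤ V) : Submodule ℤ V :=
  LinearMap.BilinForm.dualSubmodule (QuadraticMap.associated Q) L

/-- The orthogonal complement `V^ξ` of `ξ`. -/
def perp (Q : QuadraticForm ℚ V) (ξ : V) : Submodule ℚ V :=
  LinearMap.ker (QuadraticMap.associated Q ξ)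

/-- The lattice `L^ξ = L ∩ V^ξ`. -/
def perpLattice (Q : QuadraticForm ℚ V) (L : Submodule ℤ V) (ξ : V) : Submodule ℤ V :=
  L ⊓ (perp Q ξ).restrictScalars ℤ

/-- The dual lattice `L^{ξ*}` of `L^ξ` inside `V^ξ`. -/
def perpDual (Q : QuadraticForm ℚ V) (L : Submodule ℤ V) (ξ : V) : Submodule ℤ V :=
  dual Q (perpLattice Q L ξ) ⊓ (perp Q ξ).restrictScalars ℤ

/-- `x` is a primitive vector of `M`: it lies in `M` and is not a proper multiple in `M`. -/
def IsPrimitive (M : Submodule ℤ V) (x : V) : Prop :=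
  x ∈ M ∧ ∀ (n : ℤ), ∀ y ∈ M, x = n • y → IsUnit n

/-- `ξ` is a reduced vector of `L*`. -/
def IsReduced (Q : QuadraticForm ℚ V) (L : Submodule ℤ V) (ξ : V) : Prop :=
  IsPrimitive (dual Q L) ξ ∧ IsMaximalIn Q (perp Q ξ) (perpLattice Q L ξ)

end Rational

section Local

instance instFactPrimes (p : Nat.Primes) : Fact (p : ℕ).Prime := ⟨p.2⟩

variable {V : Type*} [AddCommGroup V] [Module ℚ V]

/-- The `p`-adic completion `V_p = ℚ_p ⊗ V`. -/
abbrev Loc (V : Type*) [AddCommGroup V] [Module ℚ V] (p : Nat.Primes) : Type _ :=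
  ℚ_[(p : ℕ)] ⊗[ℚ] V

/-- The canonical map `V → V_p`. -/
def toLoc (p : Nat.Primes) (x : V) : Loc V p := (1 : ℚ_[(p : ℕ)]) ⊗ₜ[ℚ] x

/-- The quadratic form on `V_p` that extends `Q`. -/
abbrev locForm (Q : QuadraticForm ℚ V) (p : Nat.Primes) : QuadraticForm ℚ_[(p : ℕ)] (Loc V p) :=
  Q.baseChange ℚ_[(p : ℕ)]

/-- The `ℤ_p`-lattice `L_p` in `V_p` spanned by `L`. -/
def locLattice (L : Submodule ℤ V) (p : Nat.Primes) : Submodule ℤ_[(p : ℕ)] (Loc V p) :=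
  Submodule.span ℤ_[(p : ℕ)] (toLoc p '' (L : Set V))

/-- The embedding `O(Q)(ℚ) → O(Q)(ℚ_p)`. -/
def locIsom (Q : QuadraticForm ℚ V) (p : Nat.Primes) :
    orthogonal Q →* orthogonal (locForm Q p) where
  toFun g := ⟨LinearEquiv.baseChange ℚ ℚ_[(p : ℕ)] V V g, fun x => by
    have h : (locForm Q p).comp
        (LinearEquiv.baseChange ℚ ℚ_[(p : ℕ)] V V (g : V ≃ₗ[ℚ] V)).toLinearMap = locForm Q p := by
      refine baseChange_ext fun m => ?_
      have hg : Q ((g : V ≃ₗ[ℚ] V) m) = Q m := g.2 m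
      simp [hg]
    exact congrArg (fun q : QuadraticForm ℚ_[(p : ℕ)] (Loc V p) => q x) h⟩
  map_one' := Subtype.ext (LinearEquiv.baseChange_one ℚ ℚ_[(p : ℕ)] V)
  map_mul' g h := Subtype.ext (LinearEquiv.baseChange_mul ℚ ℚ_[(p : ℕ)] V g h)

variable (Q : QuadraticForm ℚ V) (L : Submodule ℤ V) (ξ : V)

/-- `K_p = {g ∈ O(Q)(ℚ_p) | g L_p = L_p}`. -/
def K (p : Nat.Primes) : Subgroup (orthogonal (locForm Q p)) :=
  (preserving (locLattice L p)).subgroupOf (orthogonal (locForm Q p))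

/-- `K_p^* = {g ∈ K_p | (g - 1) L_p^* ⊆ L_p}`. -/
def KStar (p : Nat.Primes) : Subgroup (orthogonal (locForm Q p)) :=
  (discKernel (locLattice L p) (locLattice (dual Q L) p)).subgroupOf (orthogonal (locForm Q p))

/-- `K_p^{ξ*} = {h ∈ O(Q)(ℚ_p) | h ξ = ξ, h L^ξ_p = L^ξ_p, (h - 1) L^{ξ*}_p ⊆ L^ξ_p}`. -/
def KPerpStar (p : Nat.Primes) : Subgroup (orthogonal (locForm Q p)) :=
  (fixing (toLoc p ξ) ⊓
    discKernel (locLattice (perpLattice Q L ξ) p) (locLattice (perpDual Q L ξ) p)).subgroupOf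
      (orthogonal (locForm Q p))

end Local

section Adelic

variable {V : Type*} [AddCommGroup V] [Module ℚ V] (Q : QuadraticForm ℚ V) (L : Submodule ℤ V)
  (ξ : V)

/-- `O(Q)(𝔸_f)`: the restricted product of the groups `O(Q)(ℚ_p)` with respect to the `K_p`. -/
abbrev Adelic : Type _ := Πʳ p : Nat.Primes, [orthogonal (locForm Q p), K Q L p]

/-- `K_f = ∏ K_p`. -/
def Kfin : Subgroup (Adelic Q L) where
  carrier := {g | ∀ p, g p ∈ K Q L p}
  mul_mem' hg hh p := mul_mem (hg p) (hh p)
  one_mem' _ := one_mem _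
  inv_mem' hg p := inv_mem (hg p)

/-- `O(Q)(ℚ)` inside `O(Q)(𝔸_f)`. -/
def rationalPoints : Subgroup (Adelic Q L) where
  carrier := {g | ∃ γ : orthogonal Q, ∀ p, g p = locIsom Q p γ}
  mul_mem' := by
    rintro g h ⟨γ, hγ⟩ ⟨δ, hδ⟩
    exact ⟨γ * δ, fun p => by rw [map_mul, ← hγ, ← hδ]; rfl⟩
  one_mem' := ⟨1, fun p => by rw [map_one]; rfl⟩
  inv_mem' := by
    rintro g ⟨γ, hγ⟩
    exact ⟨γ⁻¹, fun p => by rw [map_inv, ← hγ]; rfl⟩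

/-- `G^ξ(𝔸_f)`: the stabilizer of `ξ` in `O(Q)(𝔸_f)`. -/
def AdelicStab : Subgroup (Adelic Q L) where
  carrier := {g | ∀ p, (g p : Loc V p ≃ₗ[ℚ_[(p : ℕ)]] Loc V p) ∈ fixing (toLoc p ξ)}
  mul_mem' hg hh p := mul_mem (hg p) (hh p)
  one_mem' _ := one_mem _
  inv_mem' hg p := inv_mem (hg p)

/-- `G^ξ(ℚ)` inside `G^ξ(𝔸_f)`. -/
def rationalStab : Subgroup (AdelicStab Q L ξ) :=
  (rationalPoints Q L).subgroupOf (AdelicStab Q L ξ)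

/-- `K_f^{ξ*} = ∏ K_p^{ξ*}` inside `G^ξ(𝔸_f)`. -/
def KPerpStarFin : Subgroup (AdelicStab Q L ξ) where
  carrier := {h | ∀ p, (h : Adelic Q L) p ∈ KPerpStar Q L ξ p}
  mul_mem' hg hh p := mul_mem (hg p) (hh p)
  one_mem' _ := one_mem _
  inv_mem' hg p := inv_mem (hg p)

variable {Q L}

/-- The lattice `L(u) = V ∩ ∏ u_p L_p`. -/
def latticeOf (u : Adelic Q L) : Submodule ℤ V where
  carrier := {x | ∀ p, ((u p)⁻¹ : orthogonal (locForm Q p)).1 (toLoc p x) ∈ locLattice L p}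
  add_mem' {x y} hx hy p := by
    have h := add_mem (hx p) (hy p)
    rw [← map_add] at h
    simpa only [toLoc, TensorProduct.tmul_add] using h
  zero_mem' p := by simp [toLoc]
  smul_mem' n x hx p := by
    have h := zsmul_mem (hx p) n
    rw [← map_zsmul] at h
    simpa only [toLoc, TensorProduct.tmul_smul] using h

/-- The arithmetic group `Γ(u) = O(Q)(ℚ) ∩ ∏ u_p K_p u_p⁻¹`. -/
def arithGroup (u : Adelic Q L) : Subgroup (V ≃ₗ[ℚ] V) :=
  Subgroup.map (orthogonal Q).subtype
    (⨅ p, Subgroup.comap (locIsom Q p) (Subgroup.map (MulAut.conj (u p)).toMonoidHom (K Q L p)))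

/-- `L(u)^*_{prim,[Δ]}`: the primitive vectors `η` of the lattice dual to `L(u)` with `Q(η) = Δ`. -/
def primVectors (u : Adelic Q L) (Δ : ℚ) : Type _ :=
  {η : V // IsPrimitive (dual Q (latticeOf u)) η ∧ Q η = Δ}

/-- Two vectors of `L(u)^*_{prim,[Δ]}` are equivalent if they lie in one `Γ(u)`-orbit. -/
def primSetoid (u : Adelic Q L) (Δ : ℚ) : Setoid (primVectors u Δ) :=
  (MulAction.orbitRel (arithGroup u) V).comap Subtype.val

/-- The set of orbits `Γ(u) \ L(u)^*_{prim,[Δ]}`. -/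
def PrimOrbits (u : Adelic Q L) (Δ : ℚ) : Type _ := Quotient (primSetoid u Δ)

/-- The orbit of a vector. -/
def orbitOf {u : Adelic Q L} {Δ : ℚ} (η : primVectors u Δ) : PrimOrbits u Δ :=
  Quotient.mk (primSetoid u Δ) η

end Adelic

section Rational

variable {V : Type*} [AddCommGroup V] [Module ℚ V] {Q : QuadraticForm ℚ V} {L : Submodule ℤ V}

theorem exists_den (hspan : Submodule.span ℚ (L : Set V) = ⊤) (y : V) :
    ∃ N : ℕ, N ≠ 0 ∧ N • y ∈ L := by
  have hy : y ∈ Submodule.span ℚ (L : Set V) := hspan ▸ Submodule.mem_top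
  induction hy using Submodule.span_induction with
  | mem x hx => exact ⟨1, one_ne_zero, by simpa using hx⟩
  | zero => exact ⟨1, one_ne_zero, by simp⟩
  | add x y _ _ hx hy =>
    obtain ⟨N, hN, hNx⟩ := hx
    obtain ⟨M, hM, hMy⟩ := hy
    refine ⟨M * N, mul_ne_zero hM hN, ?_⟩
    rw [smul_add]
    refine add_mem ?_ ?_
    · rw [mul_smul]; exact nsmul_mem hNx M
    · rw [mul_comm, mul_smul]; exact nsmul_mem hMy N
  | smul a x _ hx =>
    obtain ⟨N, hN, hNx⟩ := hx
    refine ⟨a.den * N, mul_ne_zero a.den_nz hN, ?_⟩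
    have h : (a.den * N) • a • x = a.num • (N • x) := by
      rw [← Nat.cast_smul_eq_nsmul ℚ, ← Nat.cast_smul_eq_nsmul ℚ N, ← Int.cast_smul_eq_zsmul ℚ,
        smul_smul, smul_smul]
      congr 1
      push_cast
      rw [mul_right_comm, Rat.den_mul_eq_num]
    rw [h]
    exact zsmul_mem hNx _

theorem eventually_map_le (hfg : L.FG) (hspan : Submodule.span ℚ (L : Set V) = ⊤)
    (γ : orthogonal Q) : ∀ᶠ p : Nat.Primes in Filter.cofinite,
      ∀ x ∈ locLattice L p, (locIsom Q p γ).1 x ∈ locLattice L p := by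
  obtain ⟨N, hN, hNL⟩ : ∃ N : ℕ, N ≠ 0 ∧ ∀ x ∈ L, N • γ.1 x ∈ L := by
    obtain ⟨S, rfl⟩ := hfg
    choose d hd hdL using exists_den hspan
    refine ⟨∏ s ∈ S, d (γ.1 s), Finset.prod_ne_zero_iff.2 fun s _ => hd _, fun x hx => ?_⟩
    induction hx using Submodule.span_induction with
    | mem s hs =>
      obtain ⟨k, hk⟩ := Finset.dvd_prod_of_mem (fun s => d (γ.1 s)) hs
      rw [hk, mul_comm, mul_smul]
      exact nsmul_mem (hdL _) k
    | zero => simp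
    | add x y _ _ hx hy => rw [map_add, smul_add]; exact add_mem hx hy
    | smul a x _ hx => rw [map_zsmul, smul_comm]; exact zsmul_mem hx a
  have hfin : {p : Nat.Primes | (p : ℕ) ∣ N}.Finite := by
    refine Set.Finite.of_finite_image (f := fun p : Nat.Primes => (p : ℕ))
      ((Set.finite_Iic N).subset ?_) (fun _ _ _ _ h => Subtype.ext h)
    rintro _ ⟨p, hp, rfl⟩
    exact Nat.le_of_dvd (Nat.pos_of_ne_zero hN) hp
  refine (Filter.eventually_cofinite.2 (by simpa using hfin) :
    ∀ᶠ p : Nat.Primes in Filter.cofinite, ¬ (p : ℕ) ∣ N).mono fun p hp x hx => ?_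
  have hu : IsUnit (N : ℤ_[(p : ℕ)]) := by
    rw [PadicInt.isUnit_iff, PadicInt.norm_natCast_eq_one_iff]
    exact (p.2.coprime_iff_not_dvd).2 hp
  induction hx using Submodule.span_induction with
  | mem x hx =>
    obtain ⟨y, hy, rfl⟩ := hx
    have h1 : toLoc p (N • γ.1 y) ∈ locLattice L p :=
      Submodule.subset_span ⟨_, hNL y hy, rfl⟩
    have h2 : toLoc p (N • γ.1 y) = (N : ℤ_[(p : ℕ)]) • (locIsom Q p γ).1 (toLoc p y) := by
      rw [Nat.cast_smul_eq_nsmul]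
      simp [toLoc, locIsom]
    rw [h2] at h1
    obtain ⟨v, hv⟩ := hu
    rw [← hv] at h1
    have h3 := Submodule.smul_mem _ (↑v⁻¹ : ℤ_[(p : ℕ)]) h1
    rwa [smul_smul, Units.inv_mul, one_smul] at h3
  | zero => simp
  | add x y _ _ hx hy => rw [map_add]; exact add_mem hx hy
  | smul a x _ hx =>
    have h : (locIsom Q p γ).1 (a • x) = a • (locIsom Q p γ).1 x :=
      LinearMap.map_smul_of_tower (locIsom Q p γ).1.toLinearMap a x
    rw [h]
    exact Submodule.smul_mem _ a hx

/-- Every element of `O(Q)(ℚ)` gives a point of `O(Q)(𝔸_f)`. -/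
theorem exists_rationalPoint (hfg : L.FG) (hspan : Submodule.span ℚ (L : Set V) = ⊤)
    (γ : orthogonal Q) : ∃ g ∈ rationalPoints Q L, ∀ p, g p = locIsom Q p γ := by
  refine ⟨⟨fun p => locIsom Q p γ, ?_⟩, ⟨γ, fun _ => rfl⟩, fun _ => rfl⟩
  filter_upwards [eventually_map_le hfg hspan γ, eventually_map_le hfg hspan γ⁻¹] with p h1 h2 x
  refine ⟨fun hx => ?_, h1 x⟩
  have h3 := h2 _ hx
  have h4 : (locIsom Q p γ⁻¹).1 ((locIsom Q p γ).1 x) = x := by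
    have h5 : (locIsom Q p γ⁻¹) * (locIsom Q p γ) = 1 := by rw [← map_mul, inv_mul_cancel, map_one]
    exact congrArg (fun g : orthogonal (locForm Q p) => g.1 x) h5
  exact h4 ▸ h3

end Rational

end QuadLattice

end

/-! The heart of the matter is local: K_p acts transitively on the primitive vectors of L_p^* of a
given norm (`exists_isom_of_primitive`). Let x, y be two such vectors. Since K_p = K_p^*, the
negation and every reflection preserving L_p act trivially on L_p^*/L_p. If x - y were not in L_p,
maximality would make Q(x - y)/2 non-integral; the reflection in x - y would then preserve L_p and
take x to y, so triviality would put x - y in L_p after all. Hence x and y are always congruent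
modulo L_p. As V is isotropic and L maximal, L contains a hyperbolic plane, and Eichler
transformations together with reflections in that plane turn the congruence into an element of K_p
carrying x to y.

The global part is a comparison of orbits. Write h in G^ξ(𝔸_f) as γ u_j k and put η = γ⁻¹ξ; then
u_j⁻¹η = kξ at every prime, so η is primitive in L(u_j)^*. This relation, `Corresponds`, determines
j and the Γ(u_j)-orbit of η from h, and determines h from η up to G^ξ(ℚ) on the left and K_f ∩
G^ξ(𝔸_f) on the right. Every η occurs: a reduced ξ is anisotropic (`IsReduced.form_ne_zero`), so
reflections give a rational γ with γη = ξ, and local transitivity supplies k (`exists_corresponds`).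

It remains to see that K_f ∩ G^ξ(𝔸_f) = K_f^{ξ*} (`KPerpStarFin_eq`), which uses primitivity of ξ
and K_p = K_p^*, and that conjugation by γ identifies the two stabilizers (`Corresponds.mk_eq`). -/

set_option linter.unusedSectionVars false

open QuadLattice

namespace QuadLattice

/-! ### Reflections and Eichler transformations over a field -/

section Field

variable {k E : Type*} [Field k] [Invertible (2 : k)] [AddCommGroup E] [Module k E]
  (Q : QuadraticForm k E)

local notation "B" => QuadraticMap.associated Q

theorem assoc_comm (x y : E) : B x y = B y x := QuadraticMap.associated_isSymm k Q x y

theorem assoc_self (x : E) : B x x = Q x := QuadraticMap.associated_eq_self_apply k Q x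

theorem form_add (x y : E) : Q (x + y) = Q x + Q y + 2 * B x y := by
  rw [← assoc_self, ← assoc_self Q x, ← assoc_self Q y, map_add, map_add, LinearMap.add_apply,
    LinearMap.add_apply, assoc_comm Q y x]
  ring

theorem form_sub (x y : E) : Q (x - y) = Q x + Q y - 2 * B x y := by
  rw [sub_eq_add_neg, form_add, QuadraticMap.map_neg, map_neg]
  ring

theorem form_smul (a : k) (x : E) : Q (a • x) = a ^ 2 * Q x := by
  rw [QuadraticMap.map_smul, smul_eq_mul, sq]

theorem assoc_isom (g : orthogonal Q) (x y : E) : B (g.1 x) (g.1 y) = B x y := by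
  have h := form_add Q (g.1 x) (g.1 y)
  rw [← map_add, g.2, g.2, g.2, form_add] at h
  have h2 : (2 : k) ≠ 0 := Invertible.ne_zero 2
  exact (mul_left_cancel₀ h2 (add_left_cancel h)).symm

theorem coroot_apply_self (w : E) (hw : Q w ≠ 0) : ((2 / Q w) • B w) w = 2 := by
  rw [LinearMap.smul_apply, assoc_self, smul_eq_mul, div_mul_cancel₀ _ hw]

/-- The reflection in an anisotropic vector. -/
def reflect (w : E) (hw : Q w ≠ 0) : orthogonal Q :=
  ⟨Module.reflection (coroot_apply_self Q w hw), fun x => by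
    rw [Module.reflection_apply, form_sub, form_smul, map_smul, LinearMap.smul_apply,
      assoc_comm Q w x, smul_eq_mul, smul_eq_mul]
    field_simp
    ring⟩

variable {Q}

theorem reflect_apply {w : E} (hw : Q w ≠ 0) (x : E) :
    (reflect Q w hw).1 x = x - (2 / Q w * B w x) • w :=
  Module.reflection_apply x (coroot_apply_self Q w hw)

theorem reflect_reflect {w : E} (hw : Q w ≠ 0) (x : E) :
    (reflect Q w hw).1 ((reflect Q w hw).1 x) = x :=
  Module.involutive_reflection (coroot_apply_self Q w hw) x

theorem reflect_sub {x y : E} (h : Q x = Q y) (hw : Q (x - y) ≠ 0) :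
    (reflect Q (x - y) hw).1 x = y := by
  have h1 : 2 * B (x - y) x = Q (x - y) := by
    rw [form_sub, map_sub, LinearMap.sub_apply, assoc_self, assoc_comm Q y x, h]
    ring
  rw [reflect_apply, div_mul_eq_mul_div, h1, div_self hw, one_smul, sub_sub_cancel]

/-- The negation, as an isometry. -/
def negIsom : orthogonal Q := ⟨LinearEquiv.neg k, fun x => QuadraticMap.map_neg Q x⟩

theorem negIsom_apply (x : E) : (negIsom (Q := Q)).1 x = -x := rfl

/-- The orthogonal group acts transitively on the vectors of a given nonzero norm. -/
theorem exists_isom_apply_eq {x y : E} (h : Q x = Q y) (h0 : Q x ≠ 0) :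
    ∃ g : orthogonal Q, g.1 x = y := by
  by_cases h1 : Q (x - y) = 0
  -- By the parallelogram law Q(x - y) + Q(x + y) = 4 Q(x) ≠ 0, so x - y and x + y are not both
  -- isotropic. The reflection in x + y takes x to -y, and a negation repairs the sign.
  · have h2 : Q (x - -y) ≠ 0 := fun h2 => by
      rw [form_sub, QuadraticMap.map_neg, map_neg] at h2
      rw [form_sub] at h1
      have : (2 : k) * (2 * Q x) = 0 := by linear_combination h1 + h2 + 2 * h
      have h3 : (2 : k) ≠ 0 := Invertible.ne_zero 2
      exact mul_ne_zero h3 (mul_ne_zero h3 h0) this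
    refine ⟨negIsom * reflect Q (x - -y) h2, ?_⟩
    have h3 := reflect_sub (h.trans (QuadraticMap.map_neg Q y).symm) h2
    change -((reflect Q (x - -y) h2).1 x) = y
    rw [h3, neg_neg]
  · exact ⟨reflect Q _ h1, reflect_sub h h1⟩

variable (Q) in
/-- The linear map `x ↦ x - B(e, x) m + B(m, x) e - 2⁻¹ Q(m) B(e, x) e`. -/
def eichlerMap (e m : E) : E →ₗ[k] E :=
  LinearMap.id - (B e).smulRight m + (B m).smulRight e - ((Q m / 2) • B e).smulRight e

theorem eichlerMap_apply (e m x : E) :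
    eichlerMap Q e m x = x - B e x • m + B m x • e - (Q m / 2 * B e x) • e := rfl

theorem eichlerMap_neg {e m : E} (he : Q e = 0) (hem : B e m = 0) (x : E) :
    eichlerMap Q e (-m) (eichlerMap Q e m x) = x := by
  have h2 : (2 : k) ≠ 0 := Invertible.ne_zero 2
  simp only [eichlerMap_apply, map_sub, map_add, map_smul, map_neg, LinearMap.neg_apply,
    QuadraticMap.map_neg, assoc_self, he, hem, assoc_comm Q m e]
  match_scalars <;> field_simp <;> ring

variable (Q) in
/-- The Eichler transformation attached to an isotropic vector `e` and a vector `m ⊥ e`. -/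
def eichler (e m : E) (he : Q e = 0) (hem : B e m = 0) : orthogonal Q :=
  ⟨LinearEquiv.ofLinearMap (eichlerMap Q e m) (eichlerMap Q e (-m))
      (LinearMap.ext fun x => by
        have := eichlerMap_neg (m := -m) he (by rw [map_neg, hem, neg_zero]) x
        rwa [neg_neg] at this)
      (LinearMap.ext fun x => eichlerMap_neg he hem x), fun x => by
    have h2 : (2 : k) ≠ 0 := Invertible.ne_zero 2
    change Q (eichlerMap Q e m x) = Q x
    rw [eichlerMap_apply]
    simp only [form_sub, form_add, form_smul, map_sub, map_add, map_smul, LinearMap.sub_apply,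
      LinearMap.add_apply, LinearMap.smul_apply, smul_eq_mul, assoc_self, he, hem,
      assoc_comm Q m e, assoc_comm Q x m, assoc_comm Q x e]
    field_simp
    ring⟩

theorem eichler_apply {e m : E} (he : Q e = 0) (hem : B e m = 0) (x : E) :
    (eichler Q e m he hem).1 x = x - B e x • m + B m x • e - (Q m / 2 * B e x) • e := rfl

end Field

section Preserving

variable {R A E : Type*} [CommRing R] [CommRing A] [Algebra R A]
  [AddCommGroup E] [Module R E] [Module A E] [IsScalarTower R A E]

theorem mem_preserving_of_le {M : Submodule R E} {g : E ≃ₗ[A] E} (h1 : ∀ x ∈ M, g x ∈ M)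
    (h2 : ∀ x ∈ M, g⁻¹ x ∈ M) : g ∈ preserving M := fun x => by
  refine ⟨fun h => ?_, h1 x⟩
  have h3 := h2 _ h
  rwa [← LinearEquiv.mul_apply, inv_mul_cancel] at h3

end Preserving

/-! ### Dual lattices and primitive vectors over the p-adic integers -/

section Padic

variable {p : ℕ} [Fact p.Prime] {E : Type*} [AddCommGroup E] [Module ℚ_[p] E] [Module ℤ_[p] E]
  [IsScalarTower ℤ_[p] ℚ_[p] E] {Q : QuadraticForm ℚ_[p] E} {L : Submodule ℤ_[p] E}

local notation "B" => QuadraticMap.associated Q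

theorem padic_smul_mem {c : ℚ_[p]} (hc : c ∈ PadicInt.subring p) {x : E} (hx : x ∈ L) :
    c • x ∈ L := by
  obtain ⟨z, rfl⟩ : ∃ z : ℤ_[p], algebraMap ℤ_[p] ℚ_[p] z = c := ⟨⟨c, hc⟩, rfl⟩
  rw [algebraMap_smul]
  exact L.smul_mem z hx

theorem algebraMap_mem_subring (c : ℤ_[p]) : algebraMap ℤ_[p] ℚ_[p] c ∈ PadicInt.subring p := c.2

theorem inv_mem_of_norm_eq_one {c : ℚ_[p]} (hc : ‖c‖ = 1) : c⁻¹ ∈ PadicInt.subring p := by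
  change ‖c⁻¹‖ ≤ 1
  rw [norm_inv, hc, inv_one]

theorem mem_of_norm_eq_one {c : ℚ_[p]} (hc : ‖c‖ = 1) : c ∈ PadicInt.subring p := hc.le

theorem norm_add_eq_one {a b : ℚ_[p]} (ha : ‖a‖ < 1) (hb : ‖b‖ = 1) : ‖a + b‖ = 1 := by
  have h : ‖a‖ ≠ ‖b‖ := by rw [hb]; exact ha.ne
  rw [Padic.add_eq_max_of_ne h, hb, max_eq_right ha.le]

variable (Q L) in
/-- The dual lattice in a `p`-adic quadratic space. -/
def padicDual : Submodule ℤ_[p] E where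
  carrier := {x | ∀ y ∈ L, B x y ∈ PadicInt.subring p}
  add_mem' hx hy z hz := by
    rw [map_add, LinearMap.add_apply]
    exact add_mem (hx z hz) (hy z hz)
  zero_mem' z _ := by
    rw [map_zero, LinearMap.zero_apply]
    exact zero_mem _
  smul_mem' c x hx z hz := by
    rw [← algebraMap_smul ℚ_[p] c x, map_smul, LinearMap.smul_apply]
    exact mul_mem (algebraMap_mem_subring c) (hx z hz)

variable (Q L) in
/-- The vectors of the dual lattice that are not divisible by `p` in it. -/
def IsPadicPrimitive (x : E) : Prop := x ∈ padicDual Q L ∧ ∃ y ∈ L, ‖B x y‖ = 1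

theorem isom_mem_padicDual {g : orthogonal Q} (hg : g.1 ∈ preserving L) {x : E}
    (hx : x ∈ padicDual Q L) : g.1 x ∈ padicDual Q L := fun y hy => by
  have h := hx ((g⁻¹).1 y) (((inv_mem hg : g.1⁻¹ ∈ preserving L) y).2 hy)
  rw [← assoc_isom Q g] at h
  rwa [show g.1 ((g⁻¹).1 y) = y from g.1.apply_symm_apply y] at h

theorem IsPadicPrimitive.isom {g : orthogonal Q} (hg : g.1 ∈ preserving L) {x : E}
    (hx : IsPadicPrimitive Q L x) : IsPadicPrimitive Q L (g.1 x) := by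
  obtain ⟨h1, y, hy, h2⟩ := hx
  exact ⟨isom_mem_padicDual hg h1, g.1 y, (hg y).2 hy, by rwa [assoc_isom]⟩

/-- Together with `padic_norm_ge_of_one_lt` this gives |Q(v)| ≥ 1 as soon as Q(v)/2 is not integral,
with no separate treatment of p = 2. -/
theorem padic_norm_two_ge : (p : ℝ)⁻¹ ≤ ‖(2 : ℚ_[p])‖ := by
  have hp : (1 : ℝ) < p := by exact_mod_cast (Fact.out : p.Prime).one_lt
  by_cases h : p = 2
  · subst h
    have := Padic.norm_p (p := 2)
    push_cast at this ⊢
    exact this.ge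
  · have h2 : ‖((2 : ℤ) : ℚ_[p])‖ = 1 := by
      by_contra h3
      have h4 := Padic.norm_intCast_lt_one_iff.1 (lt_of_le_of_ne (Padic.norm_int_le_one 2) h3)
      exact h ((Nat.prime_dvd_prime_iff_eq Fact.out Nat.prime_two).1 (by exact_mod_cast h4))
    push_cast at h2
    rw [h2]
    exact inv_le_one_of_one_le₀ hp.le

theorem padic_norm_ge_of_one_lt {x : ℚ_[p]} (hx : 1 < ‖x‖) : (p : ℝ) ≤ ‖x‖ := by
  by_contra h
  have h1 := (Padic.norm_le_pow_iff_norm_lt_pow_add_one x 0).2 (by simpa using not_le.1 h)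
  rw [zpow_zero] at h1
  exact absurd hx (not_lt.2 h1)

theorem padic_norm_lt_one_iff {x : ℚ_[p]} : ‖x‖ < 1 ↔ ‖(p : ℚ_[p])⁻¹ * x‖ ≤ 1 := by
  have hp : (0 : ℝ) < p := by exact_mod_cast (Fact.out : p.Prime).pos
  rw [norm_mul, norm_inv, Padic.norm_p, inv_inv]
  have h := Padic.norm_le_pow_iff_norm_lt_pow_add_one x (-1)
  rw [neg_add_cancel, zpow_zero] at h
  rw [← h, zpow_neg_one, ← le_div_iff₀' hp, one_div]

/-- The norm is discrete: if no value of B(x, ·) on the lattice is a unit, all are divisible by p.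
This form of primitivity is the one that compares with divisibility of rational vectors. -/
theorem isPadicPrimitive_iff {x : E} :
    IsPadicPrimitive Q L x ↔ x ∈ padicDual Q L ∧ (p : ℚ_[p])⁻¹ • x ∉ padicDual Q L := by
  refine and_congr_right fun hx => ⟨fun ⟨y, hy, h1⟩ h => ?_, fun h => ?_⟩
  · have h2 : ‖B _ _‖ ≤ 1 := h y hy
    rw [map_smul, LinearMap.smul_apply, smul_eq_mul, ← padic_norm_lt_one_iff] at h2
    exact h2.ne h1
  · by_contra h1
    push Not at h1
    refine h fun y hy => ?_
    change ‖B _ _‖ ≤ 1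
    rw [map_smul, LinearMap.smul_apply, smul_eq_mul, ← padic_norm_lt_one_iff]
    exact lt_of_le_of_ne (hx y hy) (h1 y hy)

/-! ### Isometries of a p-adic lattice and Eichler's criterion -/

theorem reflect_mem_preserving {w : E} (hw : Q w ≠ 0)
    (h : ∀ x ∈ L, (2 / Q w * B w x) • w ∈ L) : (reflect Q w hw).1 ∈ preserving L := by
  have h1 : ∀ x ∈ L, (reflect Q w hw).1 x ∈ L := fun x hx => by
    rw [reflect_apply]
    exact sub_mem hx (h x hx)
  intro x
  exact ⟨fun hx => by simpa only [reflect_reflect] using h1 _ hx, h1 x⟩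

/-- The reflection in a vector of the dual lattice `v` with `2v ∈ L` and `2⁻¹ Q(v)` not integral
preserves the lattice. -/
theorem reflect_mem_preserving_of_dual {v : E} (hv : v ∈ padicDual Q L) (h2v : (2 : ℚ_[p]) • v ∈ L)
    (hQ : Q v / 2 ∉ PadicInt.subring p) (h0 : Q v ≠ 0) :
    (reflect Q v h0).1 ∈ preserving L := by
  have hp : (0 : ℝ) < p := by exact_mod_cast (Fact.out : p.Prime).pos
  refine reflect_mem_preserving h0 fun x hx => ?_
  -- The factor 2 is absorbed into 2v, which lies in L, so only B(v, x)/Q(v) has to be integral.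
  have h1 : (2 / Q v * B v x) • v = (B v x / Q v) • (2 : ℚ_[p]) • v := by
    rw [smul_smul]
    congr 1
    ring
  rw [h1]
  refine padic_smul_mem ?_ h2v
  have h3 : 1 ≤ ‖Q v‖ := by
    have h4 : (p : ℝ) ≤ ‖Q v / 2‖ := padic_norm_ge_of_one_lt (not_le.1 hQ)
    have h5 : ‖Q v‖ = ‖Q v / 2‖ * ‖(2 : ℚ_[p])‖ := by
      rw [← norm_mul, div_mul_cancel₀ _ two_ne_zero]
    rw [h5]
    calc (1 : ℝ) = p * (p : ℝ)⁻¹ := (mul_inv_cancel₀ hp.ne').symm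
      _ ≤ _ := mul_le_mul h4 padic_norm_two_ge (inv_nonneg.2 hp.le) (norm_nonneg _)
  change ‖_‖ ≤ 1
  rw [norm_div]
  exact div_le_one_of_le₀ (le_trans (hv x hx) h3) (norm_nonneg _)

theorem assoc_mem_subring (hint : ∀ x ∈ L, Q x / 2 ∈ PadicInt.subring p) {x y : E} (hx : x ∈ L)
    (hy : y ∈ L) : B x y ∈ PadicInt.subring p := by
  have h : B x y = Q (x + y) / 2 - Q x / 2 - Q y / 2 := by
    rw [form_add]
    ring
  rw [h]
  exact sub_mem (sub_mem (hint _ (add_mem hx hy)) (hint _ hx)) (hint _ hy)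

theorem eichler_mem_preserving (hint : ∀ x ∈ L, Q x / 2 ∈ PadicInt.subring p) {e m : E}
    (he : Q e = 0) (hem : B e m = 0) (heL : e ∈ L) (hmL : m ∈ L) :
    (eichler Q e m he hem).1 ∈ preserving L := by
  have key : ∀ m ∈ L, ∀ x ∈ L, x - B e x • m + B m x • e - (Q m / 2 * B e x) • e ∈ L :=
    fun m hmL x hx => sub_mem (add_mem (sub_mem hx
      (padic_smul_mem (assoc_mem_subring hint heL hx) hmL))
      (padic_smul_mem (assoc_mem_subring hint hmL hx) heL))
      (padic_smul_mem (mul_mem (hint _ hmL) (assoc_mem_subring hint heL hx)) heL)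
  exact mem_preserving_of_le (fun x hx => key m hmL x hx) fun x hx => key (-m) (neg_mem hmL) x hx

/-- The reflection in `e - t f`, for a hyperbolic pair `e, f` and a unit `t`, preserves the
lattice. -/
theorem exists_hyperbolic_reflection (hint : ∀ x ∈ L, Q x / 2 ∈ PadicInt.subring p) {e f : E}
    (heL : e ∈ L) (hfL : f ∈ L) (he : Q e = 0) (hf : Q f = 0) (hef : B e f = 1) {t : ℚ_[p]}
    (ht : ‖t‖ = 1) : ∃ g : orthogonal Q, g.1 ∈ preserving L ∧
      ∀ x, g.1 x = x + (t⁻¹ * B x e - B x f) • e + (t * B x f - B x e) • f := by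
  have ht0 : t ≠ 0 := fun h => by simp [h] at ht
  have hQ : Q (e - t • f) = -2 * t := by
    rw [form_sub, form_smul, he, hf, map_smul, hef, smul_eq_mul]
    ring
  have h0 : Q (e - t • f) ≠ 0 := by
    rw [hQ]
    exact mul_ne_zero (by norm_num) ht0
  have hw : e - t • f ∈ L := sub_mem heL (padic_smul_mem (mem_of_norm_eq_one ht) hfL)
  refine ⟨reflect Q (e - t • f) h0, reflect_mem_preserving h0 fun x hx => ?_, fun x => ?_⟩
  · refine padic_smul_mem (mul_mem ?_ (assoc_mem_subring hint hw hx)) hw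
    -- The 2 in the reflection formula cancels against Q(e - t f) = -2t, so the coefficient is
    -- integral at p = 2 as well.
    rw [hQ, show 2 / (-2 * t) = -t⁻¹ by field_simp]
    exact neg_mem (inv_mem_of_norm_eq_one ht)
  · rw [reflect_apply, hQ, map_sub, map_smul, LinearMap.sub_apply, LinearMap.smul_apply,
      assoc_comm Q e x, assoc_comm Q f x, smul_eq_mul]
    match_scalars <;> field_simp <;> ring

/-- If B(x, e) is a unit, exchanging e and f suffices. If both pairings are non-units, take y with
B(x, y) a unit and let m be its component orthogonal to the plane: the Eichler transformation
attached to e and m changes B(x, f) by B(x, y) modulo p. -/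
theorem exists_isom_norm_eq_one (hint : ∀ x ∈ L, Q x / 2 ∈ PadicInt.subring p) {e f : E}
    (heL : e ∈ L) (hfL : f ∈ L) (he : Q e = 0) (hf : Q f = 0) (hef : B e f = 1) {x : E}
    (hx : IsPadicPrimitive Q L x) : ∃ g : orthogonal Q, g.1 ∈ preserving L ∧
      ‖B (g.1 x) f‖ = 1 := by
  obtain ⟨hxd, y, hy, hxy⟩ := hx
  by_cases h1 : ‖B x f‖ = 1
  · exact ⟨1, one_mem _, h1⟩
  by_cases h2 : ‖B x e‖ = 1
  -- The parameter t = 1 gives the isometry that swaps e and f.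
  · obtain ⟨g, hg, hgx⟩ := exists_hyperbolic_reflection hint heL hfL he hf hef
      (norm_one (α := ℚ_[p]))
    refine ⟨g, hg, ?_⟩
    rw [hgx]
    simpa [hef, assoc_self, hf] using h2
  have h1' : ‖B x f‖ < 1 := lt_of_le_of_ne (hxd f hfL) h1
  have h2' : ‖B x e‖ < 1 := lt_of_le_of_ne (hxd e heL) h2
  set m := y - B y f • e - B y e • f with hm
  have hmL : m ∈ L := sub_mem (sub_mem hy (padic_smul_mem (assoc_mem_subring hint hy hfL) heL))
    (padic_smul_mem (assoc_mem_subring hint hy heL) hfL)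
  have hem : B e m = 0 := by
    simp [hm, assoc_self, he, hef, assoc_comm Q e y]
  have hfm : B m f = 0 := by
    simp [hm, assoc_self, hf, hef]
  refine ⟨eichler Q e m he hem, eichler_mem_preserving hint he hem heL hmL, ?_⟩
  have h3 : B ((eichler Q e m he hem).1 x) f =
      (B x f - B y f * B x e - B y e * B x f - Q m / 2 * B x e) + B x y := by
    rw [eichler_apply]
    simp only [map_sub, map_add, map_smul, LinearMap.sub_apply, LinearMap.add_apply,
      LinearMap.smul_apply, hfm, hef, smul_eq_mul, assoc_comm Q e x, assoc_comm Q m x]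
    rw [hm]
    simp only [map_sub, map_smul, smul_eq_mul]
    ring
  rw [h3]
  refine norm_add_eq_one ?_ hxy
  have small : ∀ {a b : ℚ_[p]}, ‖a‖ < 1 → ‖b‖ < 1 → ‖a - b‖ < 1 := fun ha hb =>
    by
      rw [sub_eq_add_neg]
      exact lt_of_le_of_lt (Padic.nonarchimedean _ _) (max_lt ha (by rwa [norm_neg]))
  have small' : ∀ {a b : ℚ_[p]}, a ∈ PadicInt.subring p → ‖b‖ < 1 → ‖a * b‖ < 1 := fun ha hb => by
    rw [norm_mul]
    exact lt_of_le_of_lt (mul_le_of_le_one_left (norm_nonneg _) ha) hb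
  exact small (small (small h1' (small' (assoc_mem_subring hint hy hfL) h2'))
    (small' (assoc_mem_subring hint hy heL) h1')) (small' (hint m hmL) h2')

/-- Eichler's criterion over `ℤ_p`, for a lattice that contains a hyperbolic plane. -/
theorem exists_isom_of_sub_mem (hint : ∀ x ∈ L, Q x / 2 ∈ PadicInt.subring p) {e f : E}
    (heL : e ∈ L) (hfL : f ∈ L) (he : Q e = 0) (hf : Q f = 0) (hef : B e f = 1) {x y : E}
    (hx : ‖B x f‖ = 1) (hy : ‖B y f‖ = 1) (hQ : Q x = Q y)
    (hxy : x - y ∈ L) : ∃ g : orthogonal Q, g.1 ∈ preserving L ∧ g.1 x = y := by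
  have hx0 : B x f ≠ 0 := fun h => by simp [h] at hx
  have hy0 : B y f ≠ 0 := fun h => by simp [h] at hy
  -- This is the component of x - y orthogonal to the plane, divided by the unit B(x, f). The
  -- Eichler transformation attached to f and m subtracts B(x, f) m, so afterwards x differs from y
  -- only inside the plane.
  set m := (B x f)⁻¹ • ((x - y) - B (x - y) f • e - B (x - y) e • f) with hm
  have hmL : m ∈ L := padic_smul_mem (inv_mem_of_norm_eq_one hx) (sub_mem (sub_mem hxy
    (padic_smul_mem (assoc_mem_subring hint hxy hfL) heL))
    (padic_smul_mem (assoc_mem_subring hint hxy heL) hfL))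
  have hfm : B f m = 0 := by
    simp [hm, assoc_self, hf, assoc_comm Q f, hef]
  set x' := (eichler Q f m hf hfm).1 x with hx'
  obtain ⟨c, hc⟩ : ∃ c, x' = y + (B x f - B y f) • e + c • f := by
    refine ⟨B x e - B y e + B m x - Q m / 2 * B x f, ?_⟩
    rw [hx', eichler_apply, assoc_comm Q f x]
    have h1 : B x f • m = (x - y) - B (x - y) f • e - B (x - y) e • f := by
      rw [hm, smul_smul, mul_inv_cancel₀ hx0, one_smul]
    rw [h1, map_sub, LinearMap.sub_apply, LinearMap.sub_apply]
    module
  have hfx' : B x' f = B x f := by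
    rw [hc]
    simp [assoc_self, hf, hef]
  have hex' : B x' e = B y e + c := by
    rw [hc]
    simp [assoc_self, he, hef, assoc_comm Q f e]
  -- Equality of the norms fixes the f-coordinate of the moved vector once its e-coordinate is
  -- known.
  have hQ' : c * B x f = (B y f - B x f) * B y e := by
    have h1 : Q x' = Q y := ((eichler Q f m hf hfm).2 x).trans hQ
    rw [hc, form_add, form_add, form_smul, form_smul, he, hf] at h1
    simp only [map_add, map_smul, LinearMap.add_apply, LinearMap.smul_apply, smul_eq_mul,
      hef] at h1
    have h2 : (2 : ℚ_[p]) * (c * B x f) = 2 * ((B y f - B x f) * B y e) := by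
      linear_combination h1
    exact mul_left_cancel₀ two_ne_zero h2
  -- The reflection with parameter t sends e to t f and f to t⁻¹ e. Following the one with parameter
  -- 1 by the one with t = B(x, f)/B(y, f) rescales e by t⁻¹ and f by t, which matches the
  -- e-coordinates; the relation for c then matches the f-coordinates.
  have ht : ‖B x f / B y f‖ = 1 := by rw [norm_div, hx, hy, div_one]
  obtain ⟨g1, hg1, hg1x⟩ := exists_hyperbolic_reflection hint heL hfL he hf hef
    (norm_one (α := ℚ_[p]))
  obtain ⟨g2, hg2, hg2x⟩ := exists_hyperbolic_reflection hint heL hfL he hf hef ht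
  refine ⟨g2 * (g1 * eichler Q f m hf hfm), mul_mem hg2 (mul_mem hg1
    (eichler_mem_preserving hint hf hfm hfL hmL)), ?_⟩
  change g2.1 (g1.1 x') = y
  have hc' : c = (B y f - B x f) * B y e / B x f := by
    rw [← hQ', mul_div_cancel_right₀ _ hx0]
  rw [hg2x, hg1x]
  simp only [map_add, map_smul, LinearMap.add_apply, LinearMap.smul_apply, assoc_self, he, hf,
    hef, assoc_comm Q f e, hfx', hex', smul_eq_mul]
  rw [hc, hc']
  match_scalars <;> field_simp <;> ring

/-- If the isometries of a maximal lattice act trivially on its discriminant group, then they act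
transitively on the primitive vectors of given norm of the dual lattice. -/
theorem exists_isom_of_primitive (hint : ∀ x ∈ L, Q x / 2 ∈ PadicInt.subring p)
    (hmax : ∀ x ∈ padicDual Q L, Q x / 2 ∈ PadicInt.subring p → x ∈ L)
    (htriv : ∀ g : orthogonal Q, g.1 ∈ preserving L → ∀ x ∈ padicDual Q L, g.1 x - x ∈ L) {e f : E}
    (heL : e ∈ L) (hfL : f ∈ L) (he : Q e = 0) (hf : Q f = 0) (hef : B e f = 1) {x y : E}
    (hx : IsPadicPrimitive Q L x) (hy : IsPadicPrimitive Q L y) (hQ : Q x = Q y) :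
    ∃ g : orthogonal Q, g.1 ∈ preserving L ∧ g.1 x = y := by
  -- Argument by contradiction: the reflection in v = x - y would preserve L, act trivially on the
  -- discriminant group, and take x to y. The required 2v ∈ L comes from the trivial action of -1.
  have hxy : x - y ∈ L := by
    have hv : x - y ∈ padicDual Q L := sub_mem hx.1 hy.1
    by_contra h
    have h1 : Q (x - y) / 2 ∉ PadicInt.subring p := fun h1 => h (hmax _ hv h1)
    have h0 : Q (x - y) ≠ 0 := fun h0 => h1 (by simp [h0])
    have h2 : (2 : ℚ_[p]) • (x - y) ∈ L := by
      have h3 := htriv negIsom (fun z => by rw [negIsom_apply, neg_mem_iff]) _ hv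
      rw [negIsom_apply] at h3
      have h4 := neg_mem h3
      rwa [neg_sub, sub_neg_eq_add, ← two_smul ℚ_[p]] at h4
    have h3 := htriv _ (reflect_mem_preserving_of_dual hv h2 h1 h0) x hx.1
    rw [reflect_sub hQ h0] at h3
    exact h (by simpa using neg_mem h3)
  obtain ⟨g1, hg1, h1⟩ := exists_isom_norm_eq_one hint heL hfL he hf hef hx
  obtain ⟨g2, hg2, h2⟩ := exists_isom_norm_eq_one hint heL hfL he hf hef hy
  have h3 : g1.1 x - g2.1 y ∈ L := by
    have h4 := sub_mem (add_mem (htriv g1 hg1 x hx.1) hxy) (htriv g2 hg2 y hy.1)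
    have h5 : g1.1 x - g2.1 y = g1.1 x - x + (x - y) - (g2.1 y - y) := by abel
    rwa [h5]
  obtain ⟨g, hg, h⟩ := exists_isom_of_sub_mem hint heL hfL he hf hef h1 h2
    ((g1.2 x).trans (hQ.trans (g2.2 y).symm)) h3
  refine ⟨g2⁻¹ * (g * g1), mul_mem (inv_mem hg2) (mul_mem hg hg1), ?_⟩
  change (g2⁻¹).1 (g.1 (g1.1 x)) = y
  rw [h]
  exact g2.1.symm_apply_apply y

end Padic

/-! ### Maximal integral lattices and primitive vectors over the integers -/

section RationalLattice

variable {V : Type*} [AddCommGroup V] [Module ℚ V] {Q : QuadraticForm ℚ V} {L : Submodule ℤ V}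

local notation "B" => QuadraticMap.associated Q

theorem mem_dual_iff {x : V} : x ∈ dual Q L ↔ ∀ y ∈ L, ∃ n : ℤ, B x y = n := by
  refine (LinearMap.BilinForm.mem_dualSubmodule _).trans (forall₂_congr fun y _ => ?_)
  rw [Submodule.mem_one]
  exact exists_congr fun n => eq_comm

theorem IsIntegralIn.assoc_int {W : Submodule ℚ V} (hL : IsIntegralIn Q W L) {x y : V}
    (hx : x ∈ L) (hy : y ∈ L) : ∃ n : ℤ, B x y = n := by
  obtain ⟨a, ha⟩ := hL.2.2 _ (add_mem hx hy)
  obtain ⟨b, hb⟩ := hL.2.2 _ hx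
  obtain ⟨c, hc⟩ := hL.2.2 _ hy
  refine ⟨a - b - c, ?_⟩
  rw [form_add] at ha
  push_cast
  linear_combination ha - hb - hc

/-- A maximal integral lattice contains every vector that can be adjoined to it. -/
theorem IsMaximalIn.mem_of_integral {W : Submodule ℚ V} (hL : IsMaximalIn Q W L) {x : V}
    (hxW : x ∈ W) (hx : ∃ n : ℤ, Q x / 2 = n) (hxL : ∀ y ∈ L, ∃ n : ℤ, B x y = n) : x ∈ L := by
  have h : IsIntegralIn Q W (L ⊔ Submodule.span ℤ {x}) := by
    refine ⟨hL.1.1.sup (Submodule.fg_span_singleton x), ?_, fun z hz => ?_⟩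
    · refine le_antisymm (Submodule.span_le.2 ?_) ?_
      · intro z hz
        obtain ⟨y, hy, w, hw, rfl⟩ := Submodule.mem_sup.1 hz
        obtain ⟨n, rfl⟩ := Submodule.mem_span_singleton.1 hw
        refine add_mem ?_ (zsmul_mem hxW n)
        rw [← hL.1.2.1]
        exact Submodule.subset_span hy
      · rw [← hL.1.2.1]
        exact Submodule.span_mono (le_sup_left (a := L))
    · obtain ⟨y, hy, w, hw, rfl⟩ := Submodule.mem_sup.1 hz
      obtain ⟨n, rfl⟩ := Submodule.mem_span_singleton.1 hw
      obtain ⟨a, ha⟩ := hL.1.2.2 y hy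
      obtain ⟨b, hb⟩ := hx
      obtain ⟨c, hc⟩ := hxL y hy
      refine ⟨a + n ^ 2 * b + n * c, ?_⟩
      rw [← Int.cast_smul_eq_zsmul ℚ, form_add, form_smul, assoc_comm, map_smul,
        LinearMap.smul_apply, hc, smul_eq_mul]
      push_cast
      linear_combination ha + n ^ 2 * hb
  rw [← hL.2 _ h le_sup_left]
  exact Submodule.mem_sup_right (Submodule.mem_span_singleton_self x)

theorem eq_zero_of_pairing_eq_zero (hnd : (QuadraticMap.associated Q).Nondegenerate)
    (hspan : Submodule.span ℚ (L : Set V) = ⊤) {x : V} (h : ∀ y ∈ L, B x y = 0) : x = 0 := by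
  refine hnd.1 x fun y => ?_
  have hy : y ∈ Submodule.span ℚ (L : Set V) := hspan ▸ Submodule.mem_top
  induction hy using Submodule.span_induction with
  | mem y hy => exact h y hy
  | zero => exact map_zero _
  | add y z _ _ hy hz => rw [map_add, hy, hz, add_zero]
  | smul a y _ hy => rw [map_smul, hy, smul_zero]

/-- The values `B(x, L)` form an ideal of `ℤ`. -/
theorem exists_generator {x : V} (hx : x ∈ dual Q L) :
    ∃ d : ℤ, ∃ w ∈ L, B x w = d ∧ ∀ y ∈ L, ∃ m : ℤ, B x y = d * m := by
  set I : Ideal ℤ := (L.map ((B x).restrictScalars ℤ)).comap (Algebra.linearMap ℤ ℚ) with hI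
  have hmem : ∀ n : ℤ, n ∈ I ↔ ∃ y ∈ L, B x y = n := fun n => by
    simp [hI, Submodule.mem_comap, Submodule.mem_map]
  obtain ⟨w, hw, hxw⟩ := (hmem _).1 (Submodule.IsPrincipal.generator_mem I)
  refine ⟨_, w, hw, hxw, fun y hy => ?_⟩
  obtain ⟨n, hn⟩ := mem_dual_iff.1 hx y hy
  obtain ⟨m, hm⟩ := (Submodule.IsPrincipal.mem_iff_generator_dvd I).1 ((hmem n).2 ⟨y, hy, hn⟩)
  exact ⟨m, by rw [hn, ← Int.cast_mul, ← hm]⟩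

/-- Dividing x by a generator d of the ideal B(x, L) makes the pairing ideal all of ℤ.
Non-degeneracy gives d ≠ 0. -/
theorem exists_pairing_eq_one (hnd : (QuadraticMap.associated Q).Nondegenerate)
    (hspan : Submodule.span ℚ (L : Set V) = ⊤) {x : V} (hx : x ≠ 0) (hxL : x ∈ dual Q L) :
    ∃ d : ℤ, d ≠ 0 ∧ (d : ℚ)⁻¹ • x ∈ dual Q L ∧ ∃ w ∈ L, B ((d : ℚ)⁻¹ • x) w = 1 := by
  obtain ⟨d, w, hw, hxw, hd⟩ := exists_generator hxL
  have hd0 : d ≠ 0 := fun h => hx (eq_zero_of_pairing_eq_zero hnd hspan fun y hy => by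
    obtain ⟨m, hm⟩ := hd y hy
    rw [hm, h, Int.cast_zero, zero_mul])
  have hd0' : (d : ℚ) ≠ 0 := Int.cast_ne_zero.2 hd0
  refine ⟨d, hd0, mem_dual_iff.2 fun y hy => ?_, w, hw, ?_⟩
  · obtain ⟨m, hm⟩ := hd y hy
    refine ⟨m, ?_⟩
    rw [map_smul, LinearMap.smul_apply, hm, smul_eq_mul, inv_mul_cancel_left₀ hd0']
  · rw [map_smul, LinearMap.smul_apply, hxw, smul_eq_mul, inv_mul_cancel₀ hd0']

theorem IsPrimitive.ne_zero {x : V} (hx : IsPrimitive L x) : x ≠ 0 := fun h => by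
  have := hx.2 0 0 (zero_mem _) (by rw [h, smul_zero])
  exact not_isUnit_zero this

theorem IsPrimitive.exists_pairing_eq_one (hnd : (QuadraticMap.associated Q).Nondegenerate)
    (hspan : Submodule.span ℚ (L : Set V) = ⊤) {x : V} (hx : IsPrimitive (dual Q L) x) :
    ∃ w ∈ L, B x w = 1 := by
  obtain ⟨d, hd0, hd, w, hw, hxw⟩ := QuadLattice.exists_pairing_eq_one hnd hspan hx.ne_zero hx.1
  have hd0' : (d : ℚ) ≠ 0 := Int.cast_ne_zero.2 hd0
  have hu := hx.2 d _ hd (by rw [← Int.cast_smul_eq_zsmul ℚ, smul_smul, mul_inv_cancel₀ hd0',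
    one_smul])
  rcases Int.isUnit_iff.1 hu with rfl | rfl
  · exact ⟨w, hw, by simpa using hxw⟩
  · refine ⟨-w, neg_mem hw, ?_⟩
    rw [← hxw]
    push_cast
    rw [map_smul, LinearMap.smul_apply, map_neg]
    norm_num

theorem mem_perp_iff {ξ x : V} : x ∈ perp Q ξ ↔ B ξ x = 0 := LinearMap.mem_ker

theorem mem_perpLattice_iff {ξ x : V} : x ∈ perpLattice Q L ξ ↔ x ∈ L ∧ B ξ x = 0 := Iff.rfl

/-- A reduced vector is anisotropic. -/
theorem IsReduced.form_ne_zero (hnd : (QuadraticMap.associated Q).Nondegenerate)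
    (hL : IsIntegralIn Q ⊤ L) {ξ : V} (hξ : IsReduced Q L ξ) : Q ξ ≠ 0 := fun h0 => by
  obtain ⟨w, hw, hξw⟩ := hξ.1.exists_pairing_eq_one hnd hL.2.1
  -- If ξ were isotropic, ξ/2 would lie in V^ξ and be orthogonal to L^ξ, so maximality would put it
  -- in L^ξ. But it pairs to 1/2 with a vector of L.
  have h : (2 : ℚ)⁻¹ • ξ ∈ perpLattice Q L ξ := by
    refine hξ.2.mem_of_integral ?_ ⟨0, ?_⟩ fun y hy => ⟨0, ?_⟩
    · rw [mem_perp_iff, map_smul, assoc_self, h0, smul_zero]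
    · rw [form_smul, h0]
      simp
    · rw [map_smul, LinearMap.smul_apply, (mem_perpLattice_iff.1 hy).2]
      simp
  obtain ⟨n, hn⟩ := hL.assoc_int h.1 hw
  rw [map_smul, LinearMap.smul_apply, hξw, smul_eq_mul, mul_one] at hn
  have h2 : (1 : ℚ) = 2 * n := by rw [← hn]; norm_num
  have h3 : (1 : ℤ) = 2 * n := by exact_mod_cast h2
  omega

theorem exists_smul_mem_dual (hL : IsIntegralIn Q ⊤ L) (x : V) :
    ∃ N : ℕ, N ≠ 0 ∧ N • x ∈ dual Q L := by
  obtain ⟨N, hN, h⟩ := exists_den hL.2.1 x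
  exact ⟨N, hN, mem_dual_iff.2 fun y hy => hL.assoc_int h hy⟩

/-- A maximal integral lattice of an isotropic space contains a hyperbolic pair. -/
theorem IsMaximalIn.exists_hyperbolic_pair (hnd : (QuadraticMap.associated Q).Nondegenerate)
    (hL : IsMaximalIn Q ⊤ L) (hiso : ∃ v : V, v ≠ 0 ∧ Q v = 0) :
    ∃ e ∈ L, ∃ f ∈ L, Q e = 0 ∧ Q f = 0 ∧ B e f = 1 := by
  obtain ⟨v, hv, hQv⟩ := hiso
  obtain ⟨N, hN, hNv⟩ := exists_smul_mem_dual hL.1 v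
  have hN0 : (N : ℚ) ≠ 0 := Nat.cast_ne_zero.2 hN
  rw [← Nat.cast_smul_eq_nsmul ℚ] at hNv
  obtain ⟨d, -, hd, w, hw, hdw⟩ :=
    exists_pairing_eq_one hnd hL.1.2.1 (smul_ne_zero hN0 hv) hNv
  set e := (d : ℚ)⁻¹ • (N : ℚ) • v with he
  have hQe : Q e = 0 := by rw [he, form_smul, form_smul, hQv, mul_zero, mul_zero]
  -- An isotropic vector of the dual lattice can be adjoined to L, so it already belongs to L.
  have heL : e ∈ L := hL.mem_of_integral Submodule.mem_top ⟨0, by simp [hQe]⟩ (mem_dual_iff.1 hd)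
  obtain ⟨n, hn⟩ := hL.1.2.2 w hw
  -- With Q(w) = 2n and B(e, w) = 1, subtracting n e makes w isotropic without changing its pairing
  -- with e.
  refine ⟨e, heL, w - n • e, sub_mem hw (zsmul_mem heL n), hQe, ?_, ?_⟩
  · rw [← Int.cast_smul_eq_zsmul ℚ, form_sub, form_smul, hQe, map_smul, assoc_comm, hdw,
      smul_eq_mul]
    linear_combination 2 * hn
  · rw [map_sub, map_zsmul, assoc_self, hQe, hdw, smul_zero, sub_zero]

/-- A lattice has a basis. -/
theorem exists_basis (hfg : L.FG) (hspan : Submodule.span ℚ (L : Set V) = ⊤) :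
    ∃ (n : ℕ) (b : Module.Basis (Fin n) ℚ V), Submodule.span ℤ (Set.range b) = L := by
  have : Module.Finite ℤ L := Module.Finite.iff_fg.2 hfg
  have : Module.IsTorsionFree ℤ V := Module.IsTorsionFree.trans ℚ
  have : Module.Free ℤ L := Module.free_of_finite_type_torsion_free'
  set b := Module.finBasis ℤ L with hb
  have h1 : LinearIndependent ℤ (fun i => (b i : V)) :=
    b.linearIndependent.map' L.subtype (Submodule.ker_subtype L)
  have h2 : Submodule.span ℤ (Set.range fun i => (b i : V)) = L := by
    have h3 := congrArg (Submodule.map L.subtype) b.span_eq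
    rw [Submodule.map_span, Submodule.map_subtype_top, ← Set.range_comp] at h3
    exact h3
  have h4 : ⊤ ≤ Submodule.span ℚ (Set.range fun i => (b i : V)) := by
    rw [← hspan, Submodule.span_le]
    intro x hx
    have hx' : x ∈ Submodule.span ℤ (Set.range fun i => (b i : V)) := by rw [h2]; exact hx
    exact Submodule.span_subset_span ℤ ℚ _ hx'
  refine ⟨_, Module.Basis.mk ((LinearIndependent.iff_fractionRing ℤ ℚ).1 h1) h4, ?_⟩
  rw [Module.Basis.coe_mk]
  exact h2

end RationalLattice

/-! ### Localization of lattices, duals and maximality -/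

section Localization

variable {V : Type*} [AddCommGroup V] [Module ℚ V] {Q : QuadraticForm ℚ V} {L : Submodule ℤ V}
  (p : Nat.Primes)

theorem toLoc_add (x y : V) : toLoc p (x + y) = toLoc p x + toLoc p y :=
  TensorProduct.tmul_add _ _ _

theorem toLoc_sub (x y : V) : toLoc p (x - y) = toLoc p x - toLoc p y :=
  TensorProduct.tmul_sub _ _ _

theorem toLoc_zero : toLoc p (0 : V) = 0 := TensorProduct.tmul_zero _ _

theorem toLoc_smul (a : ℚ) (x : V) : toLoc p (a • x) = (a : ℚ_[(p : ℕ)]) • toLoc p x := by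
  rw [toLoc, toLoc, TensorProduct.tmul_smul, TensorProduct.smul_tmul', TensorProduct.smul_tmul',
    Rat.smul_def, smul_eq_mul]

theorem toLoc_nsmul (n : ℕ) (x : V) : toLoc p (n • x) = n • toLoc p x :=
  TensorProduct.tmul_smul _ _ _

theorem toLoc_zsmul (n : ℤ) (x : V) : toLoc p (n • x) = n • toLoc p x :=
  TensorProduct.tmul_smul _ _ _

variable {p}

theorem locForm_toLoc (x : V) : locForm Q p (toLoc p x) = (Q x : ℚ_[(p : ℕ)]) := by
  simp [toLoc, Rat.smul_def]

theorem assoc_toLoc (x y : V) : QuadraticMap.associated (locForm Q p) (toLoc p x) (toLoc p y) =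
    (QuadraticMap.associated Q x y : ℚ_[(p : ℕ)]) := by
  have h := form_add (locForm Q p) (toLoc p x) (toLoc p y)
  rw [← toLoc_add, locForm_toLoc, locForm_toLoc, locForm_toLoc, form_add] at h
  push_cast at h
  exact (mul_left_cancel₀ two_ne_zero (add_left_cancel h)).symm

theorem locIsom_toLoc (g : orthogonal Q) (x : V) :
    (locIsom Q p g).1 (toLoc p x) = toLoc p (g.1 x) := by
  simp [toLoc, locIsom]

theorem toLoc_injective : Function.Injective (toLoc p : V → Loc V p) := by
  have h := Module.Flat.rTensor_preserves_injective_linearMap (M := V)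
    (Algebra.linearMap ℚ ℚ_[(p : ℕ)]) (algebraMap ℚ ℚ_[(p : ℕ)]).injective
  intro x y hxy
  have h1 : (1 : ℚ) ⊗ₜ[ℚ] x = 1 ⊗ₜ[ℚ] y := h (by simpa [toLoc] using hxy)
  simpa using congrArg (TensorProduct.lid ℚ V) h1

theorem toLoc_mem {M : Submodule ℤ V} {x : V} (hx : x ∈ M) : toLoc p x ∈ locLattice M p :=
  Submodule.subset_span ⟨x, hx, rfl⟩

theorem locLattice_mono {M N : Submodule ℤ V} (h : M ≤ N) : locLattice M p ≤ locLattice N p :=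
  Submodule.span_mono (Set.image_mono h)

theorem locLattice_le {M : Submodule ℤ V} {N : Submodule ℤ_[(p : ℕ)] (Loc V p)}
    (h : ∀ x ∈ M, toLoc p x ∈ N) : locLattice M p ≤ N :=
  Submodule.span_le.2 (Set.image_subset_iff.2 h)

theorem nsmul_mem_locLattice {M N : Submodule ℤ V} {c : ℕ} (h : ∀ x ∈ M, c • x ∈ N) {v : Loc V p}
    (hv : v ∈ locLattice M p) : c • v ∈ locLattice N p := by
  induction hv using Submodule.span_induction with
  | mem v hv =>
    obtain ⟨x, hx, rfl⟩ := hv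
    rw [← toLoc_nsmul]
    exact toLoc_mem (h x hx)
  | zero => rw [smul_zero]; exact zero_mem _
  | add v w _ _ hv hw => rw [smul_add]; exact add_mem hv hw
  | smul a v _ hv => rw [smul_comm]; exact Submodule.smul_mem _ _ hv

theorem map_padicInt_smul {E : Type*} [AddCommGroup E] [Module ℚ_[(p : ℕ)] E]
    [Module ℤ_[(p : ℕ)] E] [IsScalarTower ℤ_[(p : ℕ)] ℚ_[(p : ℕ)] E] (g : E ≃ₗ[ℚ_[(p : ℕ)]] E)
    (a : ℤ_[(p : ℕ)]) (x : E) : g (a • x) = a • g x :=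
  LinearMap.map_smul_of_tower g.toLinearMap a x

theorem intCast_mem_subring (n : ℤ) : (n : ℚ_[(p : ℕ)]) ∈ PadicInt.subring (p : ℕ) :=
  Padic.norm_int_le_one n

theorem ratCast_int_mem_subring {r : ℚ} (h : ∃ n : ℤ, r = n) :
    (r : ℚ_[(p : ℕ)]) ∈ PadicInt.subring (p : ℕ) := by
  obtain ⟨n, rfl⟩ := h
  rw [Rat.cast_intCast]
  exact intCast_mem_subring n

theorem norm_natCast_eq_one {n : ℕ} (h : ¬ (p : ℕ) ∣ n) : ‖(n : ℚ_[(p : ℕ)])‖ = 1 := by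
  by_contra h1
  have h2 := lt_of_le_of_ne (Padic.norm_int_le_one (p := p) n) (by simpa using h1)
  exact h (by exact_mod_cast Padic.norm_intCast_lt_one_iff.1 h2)

/-- A rational number that is integral at every prime is an integer. -/
theorem exists_int_of_forall_mem {r : ℚ}
    (h : ∀ p : Nat.Primes, (r : ℚ_[(p : ℕ)]) ∈ PadicInt.subring (p : ℕ)) : ∃ n : ℤ, r = n := by
  refine ⟨r.num, (Rat.den_eq_one_iff r).1 ?_ |>.symm⟩
  by_contra hd
  obtain ⟨q, hq, hqd⟩ := Nat.exists_prime_and_dvd hd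
  have hf : Fact q.Prime := ⟨hq⟩
  have h1 : ‖(r : ℚ_[q])‖ ≤ 1 := h ⟨q, hq⟩
  have h2 : ‖((r.num : ℤ) : ℚ_[q])‖ < 1 := by
    have h3 : ((r.num : ℤ) : ℚ_[q]) = (r : ℚ_[q]) * ((r.den : ℤ) : ℚ_[q]) := by
      have h5 := congrArg (Rat.cast : ℚ → ℚ_[q]) (Rat.mul_den_eq_num r)
      rw [Rat.cast_mul, Rat.cast_natCast, Rat.cast_intCast] at h5
      rw [← h5, Int.cast_natCast]
    rw [h3, norm_mul]
    exact lt_of_le_of_lt (mul_le_of_le_one_left (norm_nonneg _) h1)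
      (Padic.norm_intCast_lt_one_iff.2 (by exact_mod_cast hqd))
  have h4 : q ∣ r.num.natAbs := Int.natCast_dvd.1 (Padic.norm_intCast_lt_one_iff.1 h2)
  exact hq.ne_one (Nat.eq_one_of_dvd_coprimes r.reduced h4 hqd)

theorem toLoc_mem_padicDual_iff {M : Submodule ℤ V} {x : V} :
    toLoc p x ∈ padicDual (locForm Q p) (locLattice M p) ↔
      ∀ y ∈ M, (QuadraticMap.associated Q x y : ℚ_[(p : ℕ)]) ∈ PadicInt.subring (p : ℕ) := by
  refine ⟨fun h y hy => ?_, fun h z hz => ?_⟩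
  · rw [← assoc_toLoc]
    exact h _ (toLoc_mem hy)
  · induction hz using Submodule.span_induction with
    | mem z hz =>
      obtain ⟨y, hy, rfl⟩ := hz
      rw [assoc_toLoc]
      exact h y hy
    | zero => rw [map_zero]; exact zero_mem _
    | add y z _ _ hy hz => rw [map_add]; exact add_mem hy hz
    | smul a z _ hz =>
      rw [← algebraMap_smul ℚ_[(p : ℕ)], map_smul, smul_eq_mul]
      exact mul_mem (algebraMap_mem_subring a) hz

theorem mem_dual_iff_forall_mem_padicDual {M : Submodule ℤ V} {x : V} :
    x ∈ dual Q M ↔ ∀ p, toLoc p x ∈ padicDual (locForm Q p) (locLattice M p) := by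
  simp_rw [toLoc_mem_padicDual_iff, mem_dual_iff]
  exact ⟨fun h p y hy => ratCast_int_mem_subring (h y hy),
    fun h y hy => exists_int_of_forall_mem fun p => h p y hy⟩

theorem form_mem_subring (hL : IsIntegralIn Q ⊤ L) {x : Loc V p} (hx : x ∈ locLattice L p) :
    locForm Q p x / 2 ∈ PadicInt.subring (p : ℕ) := by
  have hB : locLattice L p ≤ padicDual (locForm Q p) (locLattice L p) := locLattice_le fun x hx =>
    toLoc_mem_padicDual_iff.2 fun y hy => ratCast_int_mem_subring (hL.assoc_int hx hy)
  induction hx using Submodule.span_induction with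
  | mem x hx =>
    obtain ⟨y, hy, rfl⟩ := hx
    have h := ratCast_int_mem_subring (p := p) (hL.2.2 y hy)
    rw [locForm_toLoc]
    exact_mod_cast h
  | zero => rw [QuadraticMap.map_zero, zero_div]; exact zero_mem _
  | add x y hx hy h1 h2 =>
    have h : locForm Q p (x + y) / 2 = locForm Q p x / 2 + locForm Q p y / 2 +
        QuadraticMap.associated (locForm Q p) x y := by
      rw [form_add]
      ring
    rw [h]
    exact add_mem (add_mem h1 h2) (hB hx _ hy)
  | smul a x _ h =>
    rw [← algebraMap_smul ℚ_[(p : ℕ)], form_smul, mul_div_assoc]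
    exact mul_mem (pow_mem (algebraMap_mem_subring a) 2) h

/-- A vector of `L_p` is congruent modulo `c L_p` to a vector of `L` that lies in `c L` away from
`p`. -/
theorem exists_approx (M : Submodule ℤ V) (p : Nat.Primes) {c : ℕ} (hc : c ≠ 0) {v : Loc V p}
    (hv : v ∈ locLattice M p) : ∃ x ∈ M, (∃ a : ℕ, ∃ l ∈ M, (p : ℕ) ^ a • x = c • l) ∧
      ∃ w ∈ locLattice M p, v - toLoc p x = c • w := by
  obtain ⟨a, c', hc', rfl⟩ := Nat.exists_eq_pow_mul_and_not_dvd hc p p.2.ne_one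
  suffices h : ∃ x ∈ M, (∃ l ∈ M, (p : ℕ) ^ a • x = ((p : ℕ) ^ a * c') • l) ∧
      ∃ w ∈ locLattice M p, v - toLoc p x = ((p : ℕ) ^ a * c') • w by
    obtain ⟨x, hx, h1, h2⟩ := h
    exact ⟨x, hx, ⟨a, h1⟩, h2⟩
  have key : ∀ y ∈ M, ∀ z : ℤ_[(p : ℕ)], ∃ x ∈ M,
      (∃ l ∈ M, (p : ℕ) ^ a • x = ((p : ℕ) ^ a * c') • l) ∧
      ∃ w ∈ locLattice M p, z • toLoc p y - toLoc p x = ((p : ℕ) ^ a * c') • w := by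
    intro y hy z
    have hu : IsUnit (c' : ℤ_[(p : ℕ)]) := by
      rw [PadicInt.isUnit_iff, PadicInt.norm_natCast_eq_one_iff]
      exact (p.2.coprime_iff_not_dvd).2 hc'
    obtain ⟨t, ht⟩ := hu
    -- Here c = p^a c' with c' a p-adic unit, and n approximates z/c' modulo p^a. Then c' n agrees
    -- with z modulo c in ℤ_p, while the factor c' makes p^a x a multiple of c.
    set n := (z * (↑t⁻¹ : ℤ_[(p : ℕ)])).appr a with hn
    obtain ⟨d, hd⟩ := Ideal.mem_span_singleton'.1 (PadicInt.appr_spec a (z * (↑t⁻¹ : ℤ_[(p : ℕ)])))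
    rw [← hn] at hd
    have hz : z = c' * n + ((p : ℕ) ^ a * c' : ℕ) * d := by
      have h1 : z = (z * ↑t⁻¹) * t := by rw [mul_assoc, Units.inv_mul, mul_one]
      rw [h1, ht]
      push_cast
      linear_combination (-(c' : ℤ_[(p : ℕ)])) * hd
    refine ⟨(c' * n) • y, nsmul_mem hy _, ⟨n • y, nsmul_mem hy _, ?_⟩, d • toLoc p y,
      Submodule.smul_mem _ _ (toLoc_mem hy), ?_⟩
    · rw [smul_smul, smul_smul, mul_assoc]
    · rw [toLoc_nsmul, ← Nat.cast_smul_eq_nsmul ℤ_[(p : ℕ)], ← Nat.cast_smul_eq_nsmul ℤ_[(p : ℕ)],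
        smul_smul, ← sub_smul]
      congr 1
      nth_rewrite 1 [hz]
      push_cast
      ring
  induction hv using Submodule.span_induction with
  | mem v hv =>
    obtain ⟨y, hy, rfl⟩ := hv
    simpa using key y hy 1
  | zero => exact ⟨0, zero_mem _, ⟨0, zero_mem _, by simp⟩, 0, zero_mem _, by simp [toLoc_zero]⟩
  | add v v' _ _ h h' =>
    obtain ⟨x, hx, ⟨l, hl, hxl⟩, w, hw, hvw⟩ := h
    obtain ⟨x', hx', ⟨l', hl', hxl'⟩, w', hw', hvw'⟩ := h'
    refine ⟨x + x', add_mem hx hx', ⟨l + l', add_mem hl hl', by rw [smul_add, smul_add, hxl, hxl']⟩,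
      w + w', add_mem hw hw', ?_⟩
    rw [smul_add, ← hvw, ← hvw', toLoc_add]
    abel
  | smul z v _ h =>
    obtain ⟨x, hx, -, w, hw, hvw⟩ := h
    obtain ⟨x', hx', hl', w', hw', hvw'⟩ := key x hx z
    refine ⟨x', hx', hl', z • w + w', add_mem (Submodule.smul_mem _ _ hw) hw', ?_⟩
    rw [smul_add, smul_comm, ← hvw, ← hvw', smul_sub]
    abel

theorem exists_pow_smul_mem (hspan : Submodule.span ℚ (L : Set V) = ⊤) (v : Loc V p) :
    ∃ k : ℕ, (p : ℕ) ^ k • v ∈ locLattice L p := by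
  induction v using TensorProduct.induction_on with
  | zero => exact ⟨0, by simp⟩
  | tmul a x =>
    obtain ⟨N, hN, hNx⟩ := exists_den hspan x
    have hN0 : (N : ℚ_[(p : ℕ)]) ≠ 0 := Nat.cast_ne_zero.2 hN
    have hp : (1 : ℝ) < (p : ℕ) := by exact_mod_cast p.2.one_lt
    obtain ⟨k, hk⟩ := pow_unbounded_of_one_lt ‖a / N‖ hp
    have h1 : (((p : ℕ) ^ k : ℕ) : ℚ_[(p : ℕ)]) * (a / N) ∈ PadicInt.subring (p : ℕ) := by
      change ‖_‖ ≤ 1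
      push_cast
      rw [norm_mul, norm_pow, Padic.norm_p, inv_pow]
      exact (inv_mul_le_one₀ (by positivity)).2 hk.le
    refine ⟨k, ?_⟩
    have h2 := padic_smul_mem h1 (toLoc_mem (p := p) hNx)
    have h3 : a ⊗ₜ[ℚ] x = a • toLoc p x := by
      rw [toLoc, TensorProduct.smul_tmul', smul_eq_mul, mul_one]
    rw [toLoc_nsmul, ← Nat.cast_smul_eq_nsmul ℚ_[(p : ℕ)] N, smul_smul, mul_assoc,
      div_mul_cancel₀ _ hN0, mul_smul, Nat.cast_smul_eq_nsmul, ← h3] at h2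
    exact h2
  | add v w hv hw =>
    obtain ⟨k, hk⟩ := hv
    obtain ⟨l, hl⟩ := hw
    refine ⟨k + l, ?_⟩
    rw [smul_add]
    refine add_mem ?_ ?_
    · rw [pow_add, mul_comm, mul_smul]
      exact nsmul_mem hk _
    · rw [pow_add, mul_smul]
      exact nsmul_mem hl _

/-- The dual of `L_p` is the localization of the dual of `L`. -/
theorem padicDual_le_locLattice_dual (hnd : (QuadraticMap.associated Q).Nondegenerate)
    (hL : IsIntegralIn Q ⊤ L) :
    padicDual (locForm Q p) (locLattice L p) ≤ locLattice (dual Q L) p := by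
  obtain ⟨n, b, hb⟩ := exists_basis hL.1 hL.2.1
  intro v hv
  set b' := LinearMap.BilinForm.dualBasis (QuadraticMap.associated Q) hnd b with hb'
  have hmem : ∀ i, b' i ∈ dual Q L := fun i => by
    rw [dual, ← hb, LinearMap.BilinForm.dualSubmodule_span_of_basis _ hnd]
    exact Submodule.subset_span ⟨i, rfl⟩
  set β := Algebra.TensorProduct.basis ℚ_[(p : ℕ)] b' with hβ
  have hβi : ∀ i, β i = toLoc p (b' i) := fun i => Algebra.TensorProduct.basis_apply b' i
  -- The coordinates of v in the dual basis are its pairings with the basis of L, hence integral.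
  have hcoord : ∀ j, QuadraticMap.associated (locForm Q p) v (toLoc p (b j)) =
      β.repr v j := fun j => by
    conv_lhs => rw [← β.sum_repr v]
    simp [hβi, assoc_toLoc, hb', LinearMap.BilinForm.apply_dualBasis_left, map_sum,
      LinearMap.sum_apply, apply_ite (Rat.cast : ℚ → ℚ_[(p : ℕ)])]
  rw [← β.sum_repr v]
  refine sum_mem fun j _ => ?_
  rw [hβi]
  refine padic_smul_mem ?_ (toLoc_mem (hmem j))
  rw [← hcoord]
  refine hv _ (toLoc_mem ?_)
  rw [← hb]
  exact Submodule.subset_span ⟨j, rfl⟩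

theorem exists_smul_dual_le (hnd : (QuadraticMap.associated Q).Nondegenerate)
    (hL : IsIntegralIn Q ⊤ L) : ∃ N : ℕ, N ≠ 0 ∧ ∀ x ∈ dual Q L, N • x ∈ L := by
  obtain ⟨n, b, hb⟩ := exists_basis hL.1 hL.2.1
  have h := LinearMap.BilinForm.dualSubmodule_span_of_basis (R := ℤ) _ hnd b
  rw [hb] at h
  set b' := LinearMap.BilinForm.dualBasis (QuadraticMap.associated Q) hnd b
  choose d hd hdL using exists_den hL.2.1
  refine ⟨∏ i, d (b' i), Finset.prod_ne_zero_iff.2 fun s _ => hd _, fun x hx => ?_⟩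
  rw [dual, h] at hx
  induction hx using Submodule.span_induction with
  | mem s hs =>
    obtain ⟨i, rfl⟩ := hs
    obtain ⟨k, hk⟩ := Finset.dvd_prod_of_mem (fun i => d (b' i)) (Finset.mem_univ i)
    rw [hk, mul_comm, mul_smul]
    exact nsmul_mem (hdL _) k
  | zero => simp
  | add x y _ _ hx hy => rw [smul_add]; exact add_mem hx hy
  | smul a x _ hx => rw [smul_comm]; exact zsmul_mem hx a

/-- The localization of a maximal integral lattice is maximal. -/
theorem IsMaximalIn.mem_locLattice (hnd : (QuadraticMap.associated Q).Nondegenerate)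
    (hL : IsMaximalIn Q ⊤ L) {v : Loc V p} (hv : v ∈ padicDual (locForm Q p) (locLattice L p))
    (hQ : locForm Q p v / 2 ∈ PadicInt.subring (p : ℕ)) : v ∈ locLattice L p := by
  obtain ⟨N, hN, hNL⟩ := exists_smul_dual_le hnd hL.1
  -- With N L^* contained in L, approximating v modulo N L_p^* leaves an error in L_p. The
  -- approximant x is rational, and Q(x)/2 is integral at p because x is close to v, and elsewhere
  -- because p^a x lies in L. Global maximality then puts x in L.
  obtain ⟨x, hx, ⟨a, l, hl, hxl⟩, w, hw, hvw⟩ :=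
    exists_approx (dual Q L) p hN (padicDual_le_locLattice_dual hnd hL.1 hv)
  have hNw : N • w ∈ locLattice L p := nsmul_mem_locLattice hNL hw
  have hvx : v = toLoc p x + N • w := by rw [← hvw]; abel
  suffices hxL : x ∈ L by
    rw [hvx]
    exact add_mem (toLoc_mem hxL) hNw
  refine hL.mem_of_integral Submodule.mem_top (exists_int_of_forall_mem fun q => ?_)
    (mem_dual_iff.1 hx)
  by_cases hqp : q = p
  · subst hqp
    have h1 : toLoc q x = v - N • w := by rw [hvx]; abel
    have h2 : ((Q x / 2 : ℚ) : ℚ_[(q : ℕ)]) = locForm Q q v / 2 + locForm Q q (N • w) / 2 -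
        QuadraticMap.associated (locForm Q q) v (N • w) := by
      rw [Rat.cast_div, ← locForm_toLoc, h1, form_sub]
      push_cast
      ring
    rw [h2]
    exact sub_mem (add_mem hQ (form_mem_subring hL.1 hNw)) (hv _ hNw)
  · have h1 : (p : ℕ) ^ a • x ∈ L := by
      rw [hxl]
      exact hNL l hl
    have h2 : ‖(((p : ℕ) ^ a : ℕ) : ℚ_[(q : ℕ)])‖ = 1 := norm_natCast_eq_one fun h =>
      hqp (Subtype.ext ((Nat.prime_dvd_prime_iff_eq q.2 p.2).1 (q.2.dvd_of_dvd_pow h)))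
    have h3 := ratCast_int_mem_subring (p := q) (hL.1.2.2 _ h1)
    rw [← Nat.cast_smul_eq_nsmul ℚ, form_smul, mul_div_assoc, Rat.cast_mul, Rat.cast_pow,
      Rat.cast_natCast] at h3
    have h4 : ‖_‖ ≤ 1 := h3
    rw [norm_mul, norm_pow, h2, one_pow, one_mul] at h4
    exact h4

end Localization

section Isometry

variable {R A E : Type*} [CommRing R] [CommRing A] [Algebra R A]
  [AddCommGroup E] [Module R E] [Module A E] [IsScalarTower R A E] {Q : QuadraticForm A E}

theorem isom_mul_apply (g h : orthogonal Q) (x : E) : (g * h).1 x = g.1 (h.1 x) := rfl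

theorem isom_inv_apply_self (g : orthogonal Q) (x : E) : (g⁻¹).1 (g.1 x) = x :=
  g.1.symm_apply_apply x

theorem isom_apply_inv_self (g : orthogonal Q) (x : E) : g.1 ((g⁻¹).1 x) = x :=
  g.1.apply_symm_apply x

end Isometry

/-! ### The group K_p^{ξ*} as the stabilizer of ξ in K_p -/

section Stabilizer

variable {V : Type*} [AddCommGroup V] [Module ℚ V] {Q : QuadraticForm ℚ V} {L : Submodule ℤ V}
  {ξ : V} {p : Nat.Primes}

/-- The lattice `L^ξ_p` is the set of vectors of `L_p` orthogonal to `ξ`. -/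
theorem mem_locLattice_perpLattice_iff {w : V} (hw : w ∈ L)
    (hξw : QuadraticMap.associated Q ξ w = 1)
    (hξ : ξ ∈ dual Q L) {v : Loc V p} : v ∈ locLattice (perpLattice Q L ξ) p ↔
      v ∈ locLattice L p ∧ QuadraticMap.associated (locForm Q p) (toLoc p ξ) v = 0 := by
  constructor
  · intro hv
    refine ⟨locLattice_mono inf_le_left hv, ?_⟩
    induction hv using Submodule.span_induction with
    | mem v hv =>
      obtain ⟨y, hy, rfl⟩ := hv
      rw [assoc_toLoc, (mem_perpLattice_iff.1 hy).2, Rat.cast_zero]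
    | zero => exact map_zero _
    | add v v' _ _ h h' => rw [map_add, h, h', add_zero]
    | smul a v _ h => rw [← algebraMap_smul ℚ_[(p : ℕ)], map_smul, h, smul_zero]
  · rintro ⟨hv, hξv⟩
    -- The map v ↦ v - B(ξ, v) w projects L into L^ξ and is the identity on vectors orthogonal to ξ.
    suffices h : v - QuadraticMap.associated (locForm Q p) (toLoc p ξ) v • toLoc p w ∈
        locLattice (perpLattice Q L ξ) p by
      rwa [hξv, zero_smul, sub_zero] at h
    clear hξv
    induction hv using Submodule.span_induction with
    | mem v hv =>
      obtain ⟨y, hy, rfl⟩ := hv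
      obtain ⟨n, hn⟩ := mem_dual_iff.1 hξ y hy
      rw [assoc_toLoc, ← toLoc_smul, ← toLoc_sub, hn, Int.cast_smul_eq_zsmul]
      refine toLoc_mem (mem_perpLattice_iff.2 ⟨sub_mem hy (zsmul_mem hw n), ?_⟩)
      rw [map_sub, map_zsmul, hξw, hn, zsmul_one, sub_self]
    | zero => simp
    | add v v' _ _ h h' =>
      rw [map_add, add_smul, add_sub_add_comm]
      exact add_mem h h'
    | smul a v _ h =>
      have h1 := Submodule.smul_mem _ a h
      rw [smul_sub, ← algebraMap_smul ℚ_[(p : ℕ)] a (_ • _), smul_smul] at h1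
      rw [← algebraMap_smul ℚ_[(p : ℕ)] a v, map_smul, smul_eq_mul]
      rwa [← algebraMap_smul ℚ_[(p : ℕ)] a v] at h1

/-- The orthogonal projection x - tξ of x ∈ L to V^ξ lies in L^{ξ*}. As g fixes ξ, (g - 1)x = (g -
1)(x - tξ), which lies in L^ξ_p. -/
theorem KPerpStar_le (hL : IsIntegralIn Q ⊤ L) (h0 : Q ξ ≠ 0) {g : orthogonal (locForm Q p)}
    (hg : g ∈ KPerpStar Q L ξ p) : g ∈ K Q L p := by
  have key : ∀ g ∈ KPerpStar Q L ξ p, ∀ v ∈ locLattice L p, g.1 v ∈ locLattice L p := by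
    intro g hg v hv
    induction hv using Submodule.span_induction with
    | mem v hv =>
      obtain ⟨x, hx, rfl⟩ := hv
      set t : ℚ := QuadraticMap.associated Q ξ x / Q ξ with ht
      have hy : x - t • ξ ∈ perpDual Q L ξ := by
        have h1 : QuadraticMap.associated Q ξ (x - t • ξ) = 0 := by
          rw [map_sub, map_smul, assoc_self, smul_eq_mul, ht, div_mul_cancel₀ _ h0, sub_self]
        refine ⟨mem_dual_iff.2 fun y hy => ?_, h1⟩
        obtain ⟨hyL, hy0⟩ := mem_perpLattice_iff.1 hy
        rw [map_sub, map_smul, LinearMap.sub_apply, LinearMap.smul_apply, hy0, smul_zero, sub_zero]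
        exact hL.assoc_int hx hyL
      have h2 := locLattice_mono inf_le_left (hg.2.2 _ (toLoc_mem hy))
      have h3 : g.1 (toLoc p ξ) = toLoc p ξ := hg.1
      rw [toLoc_sub, toLoc_smul, map_sub, map_smul] at h2
      have h4 := add_mem h2 (toLoc_mem (p := p) hx)
      rwa [Subgroup.subtype_apply, h3, sub_sub_sub_cancel_right, sub_add_cancel] at h4
    | zero => rw [map_zero]; exact zero_mem _
    | add v w _ _ hv hw => rw [map_add]; exact add_mem hv hw
    | smul a v _ hv => rw [map_padicInt_smul]; exact Submodule.smul_mem _ a hv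
  exact mem_preserving_of_le (key g hg) (key _ (inv_mem hg))

/-- Every y in L^{ξ*} becomes an element of L^* after subtracting B(y, w) ξ: for l ∈ L its pairing
is B(y, l - B(ξ, l) w), with the second argument in L^ξ. Since g fixes ξ, the condition on L_p^*
passes to L^{ξ*}_p. -/
theorem mem_KPerpStar_of_mem_KStar {w : V} (hw : w ∈ L)
    (hξw : QuadraticMap.associated Q ξ w = 1) (hξ : ξ ∈ dual Q L) {g : orthogonal (locForm Q p)}
    (hg : g ∈ KStar Q L p) (hgξ : g.1 (toLoc p ξ) = toLoc p ξ) : g ∈ KPerpStar Q L ξ p := by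
  have hperp : ∀ v, QuadraticMap.associated (locForm Q p) (toLoc p ξ) (g.1 v) =
      QuadraticMap.associated (locForm Q p) (toLoc p ξ) v := fun v => by
    conv_lhs => rw [← hgξ]
    exact assoc_isom _ g _ _
  refine ⟨hgξ, fun v => ?_, fun v hv => ?_⟩
  · rw [mem_locLattice_perpLattice_iff hw hξw hξ, mem_locLattice_perpLattice_iff hw hξw hξ]
    exact and_congr (hg.1 v) (by rw [← hperp v]; rfl)
  · induction hv using Submodule.span_induction with
    | mem v hv =>
      obtain ⟨y, ⟨hy, hξy⟩, rfl⟩ := hv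
      have hx : y - QuadraticMap.associated Q y w • ξ ∈ dual Q L := mem_dual_iff.2 fun l hl => by
        obtain ⟨n, hn⟩ := mem_dual_iff.1 hξ l hl
        have hl' : l - n • w ∈ perpLattice Q L ξ := by
          refine mem_perpLattice_iff.2 ⟨sub_mem hl (zsmul_mem hw n), ?_⟩
          rw [map_sub, map_zsmul, hξw, hn, zsmul_one, sub_self]
        obtain ⟨m, hm⟩ := mem_dual_iff.1 hy _ hl'
        refine ⟨m, ?_⟩
        rw [← hm, map_sub, map_smul, LinearMap.sub_apply, LinearMap.smul_apply, hn, map_sub,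
          map_zsmul, zsmul_eq_mul, smul_eq_mul, mul_comm]
      have h1 := hg.2 _ (toLoc_mem hx)
      rw [toLoc_sub, toLoc_smul, map_sub, map_smul, Subgroup.subtype_apply, hgξ,
        sub_sub_sub_cancel_right] at h1
      refine (mem_locLattice_perpLattice_iff hw hξw hξ).2 ⟨h1, ?_⟩
      rw [map_sub]
      exact sub_eq_zero.2 (hperp _)
    | zero => rw [map_zero, sub_zero]; exact zero_mem _
    | add v w _ _ hv hw =>
      rw [map_add, add_sub_add_comm]
      exact add_mem hv hw
    | smul a v _ hv =>
      rw [map_padicInt_smul, ← smul_sub]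
      exact Submodule.smul_mem _ a hv

end Stabilizer

/-! ### The lattices L(u) and primitivity prime by prime -/

section Adelic

variable {V : Type*} [AddCommGroup V] [Module ℚ V] {Q : QuadraticForm ℚ V} {L : Submodule ℤ V}
  {ξ : V}

theorem exists_pow_smul_map_le (hL : IsIntegralIn Q ⊤ L) {p : Nat.Primes}
    (g : orthogonal (locForm Q p)) :
    ∃ k : ℕ, ∀ v ∈ locLattice L p, g.1 ((p : ℕ) ^ k • v) ∈ locLattice L p := by
  obtain ⟨S, hS⟩ := hL.1
  choose d hd using exists_pow_smul_mem (p := p) hL.2.1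
  refine ⟨∑ s ∈ S, d (g.1 (toLoc p s)), fun v hv => ?_⟩
  induction hv using Submodule.span_induction with
  | mem v hv =>
    obtain ⟨x, hx, rfl⟩ := hv
    rw [SetLike.mem_coe, ← hS] at hx
    induction hx using Submodule.span_induction with
    | mem s hs =>
      obtain ⟨m, hm⟩ := exists_add_of_le
        (Finset.single_le_sum (f := fun s => d (g.1 (toLoc p s))) (fun _ _ => Nat.zero_le _) hs)
      rw [map_nsmul, hm, add_comm, pow_add, mul_smul]
      exact nsmul_mem (hd _) _
    | zero => rw [toLoc_zero, smul_zero, map_zero]; exact zero_mem _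
    | add x y _ _ hx hy => rw [toLoc_add, smul_add, map_add]; exact add_mem hx hy
    | smul a x _ hx => rw [toLoc_zsmul, smul_comm, map_zsmul]; exact zsmul_mem hx a
  | zero => rw [smul_zero, map_zero]; exact zero_mem _
  | add v w _ _ hv hw => rw [smul_add, map_add]; exact add_mem hv hw
  | smul a v _ hv =>
    rw [smul_comm, map_padicInt_smul]
    exact Submodule.smul_mem _ a hv

/-- Only the finitely many primes with u_p outside K_p need a denominator, so one integer serves all
primes. -/
theorem exists_smul_map_le (hL : IsIntegralIn Q ⊤ L) (u : Adelic Q L) :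
    ∃ N : ℕ, N ≠ 0 ∧ ∀ p, ∀ v ∈ locLattice L p, ((u p)⁻¹).1 (N • v) ∈ locLattice L p := by
  choose k hk using fun p => exists_pow_smul_map_le hL (u p)⁻¹
  have hfin : {p | ¬ u p ∈ K Q L p}.Finite := Filter.eventually_cofinite.1 u.2
  refine ⟨∏ p ∈ hfin.toFinset, (p : ℕ) ^ k p,
    Finset.prod_ne_zero_iff.2 fun p _ => pow_ne_zero _ p.2.ne_zero, fun p v hv => ?_⟩
  by_cases hp : u p ∈ K Q L p
  · exact ((inv_mem hp : (u p)⁻¹ ∈ K Q L p) _).2 (nsmul_mem hv _)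
  · obtain ⟨m, hm⟩ := Finset.dvd_prod_of_mem (fun p : Nat.Primes => (p : ℕ) ^ k p)
      (hfin.mem_toFinset.2 hp)
    rw [hm, mul_comm, mul_smul, map_nsmul]
    exact nsmul_mem (hk p v hv) _

/-- The localization of `L(u)` at `p` is `u_p L_p`. -/
theorem mem_locLattice_latticeOf_iff (hL : IsIntegralIn Q ⊤ L) {u : Adelic Q L} {p : Nat.Primes}
    {v : Loc V p} : v ∈ locLattice (latticeOf u) p ↔ ((u p)⁻¹).1 v ∈ locLattice L p := by
  refine ⟨fun hv => ?_, fun hv => ?_⟩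
  · induction hv using Submodule.span_induction with
    | mem v hv =>
      obtain ⟨x, hx, rfl⟩ := hv
      exact hx p
    | zero => rw [map_zero]; exact zero_mem _
    | add v w _ _ hv hw => rw [map_add]; exact add_mem hv hw
    | smul a v _ hv => rw [map_padicInt_smul]; exact Submodule.smul_mem _ a hv
  obtain ⟨N, hN, hNL⟩ := exists_smul_map_le hL u
  obtain ⟨k, hk⟩ := exists_pow_smul_mem (p := p) hL.2.1 v
  have hp0 : (((p : ℕ) ^ k : ℕ) : ℚ) ≠ 0 := Nat.cast_ne_zero.2 (pow_ne_zero _ p.2.ne_zero)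
  -- The modulus p^k N allows for the division by p^k: y = p^{-k} x satisfies v - y ∈ N L_p and p^a
  -- y ∈ N L. The first relation gives y ∈ u_p L_p; the second gives y ∈ u_q L_q at every q ≠ p,
  -- where p is a unit.
  obtain ⟨x, hx, ⟨a, l, hl, hxl⟩, w, hw, hvw⟩ :=
    exists_approx L p (mul_ne_zero (pow_ne_zero k p.2.ne_zero) hN) hk
  set y : V := (((p : ℕ) ^ k : ℕ) : ℚ)⁻¹ • x with hy
  have hxy : (p : ℕ) ^ k • y = x := by
    rw [hy, ← Nat.cast_smul_eq_nsmul ℚ, smul_smul, mul_inv_cancel₀ hp0, one_smul]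
  have hvy : v = toLoc p y + N • w := by
    have hp0' : (((p : ℕ) ^ k : ℕ) : ℚ_[(p : ℕ)]) ≠ 0 :=
      Nat.cast_ne_zero.2 (pow_ne_zero _ p.2.ne_zero)
    have h1 : (p : ℕ) ^ k • v = (p : ℕ) ^ k • (toLoc p y + N • w) := by
      rw [smul_add, ← toLoc_nsmul, hxy, smul_smul, ← hvw]
      abel
    rw [← Nat.cast_smul_eq_nsmul ℚ_[(p : ℕ)], ← Nat.cast_smul_eq_nsmul ℚ_[(p : ℕ)] ((p : ℕ) ^ k)] at h1
    exact smul_right_injective _ hp0' h1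
  have hNlat : ∀ z ∈ L, N • z ∈ latticeOf u := fun z hz q => by
    rw [toLoc_nsmul]
    exact hNL q _ (toLoc_mem hz)
  have hyL : y ∈ latticeOf u := fun q => by
    by_cases hqp : q = p
    · subst hqp
      have h1 : toLoc q y = v - N • w := by rw [hvy]; abel
      rw [h1, map_sub]
      exact sub_mem hv (hNL q w hw)
    · have h1 : (p : ℕ) ^ a • y = N • l := by
        have h2 : (p : ℕ) ^ k • ((p : ℕ) ^ a • y) = (p : ℕ) ^ k • (N • l) := by
          rw [smul_comm, hxy, hxl, mul_smul]
        rw [← Nat.cast_smul_eq_nsmul ℚ ((p : ℕ) ^ k), ← Nat.cast_smul_eq_nsmul ℚ ((p : ℕ) ^ k)] at h2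
        exact smul_right_injective _ hp0 h2
      have h2 : ‖(((p : ℕ) ^ a : ℕ) : ℚ_[(q : ℕ)])‖ = 1 := norm_natCast_eq_one fun h =>
        hqp (Subtype.ext ((Nat.prime_dvd_prime_iff_eq q.2 p.2).1 (q.2.dvd_of_dvd_pow h)))
      have h3 : (((p : ℕ) ^ a : ℕ) : ℚ_[(q : ℕ)]) ≠ 0 := fun h => by simp [h] at h2
      have h4 := padic_smul_mem (inv_mem_of_norm_eq_one h2) (hNL q _ (toLoc_mem hl))
      rwa [← toLoc_nsmul, ← h1, toLoc_nsmul, map_nsmul, ← Nat.cast_smul_eq_nsmul ℚ_[(q : ℕ)],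
        smul_smul, inv_mul_cancel₀ h3, one_smul] at h4
  rw [hvy]
  exact add_mem (toLoc_mem hyL) (nsmul_mem_locLattice hNlat hw)

theorem isPadicPrimitive_latticeOf_iff (hL : IsIntegralIn Q ⊤ L) {u : Adelic Q L} {p : Nat.Primes}
    {v : Loc V p} : IsPadicPrimitive (locForm Q p) (locLattice (latticeOf u) p) v ↔
      IsPadicPrimitive (locForm Q p) (locLattice L p) (((u p)⁻¹).1 v) := by
  have h1 : ∀ z, z ∈ locLattice L p ↔ (u p).1 z ∈ locLattice (latticeOf u) p := fun z => by
    rw [mem_locLattice_latticeOf_iff hL, isom_inv_apply_self]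
  have h2 : ∀ z, QuadraticMap.associated (locForm Q p) (((u p)⁻¹).1 v) z =
      QuadraticMap.associated (locForm Q p) v ((u p).1 z) := fun z => by
    rw [← assoc_isom _ (u p), isom_apply_inv_self]
  refine and_congr ⟨fun h z hz => ?_, fun h z hz => ?_⟩ ⟨?_, ?_⟩
  · rw [h2]
    exact h _ ((h1 z).1 hz)
  · have h3 := h _ ((mem_locLattice_latticeOf_iff hL).1 hz)
    rwa [h2, isom_apply_inv_self] at h3
  · rintro ⟨z, hz, h⟩
    refine ⟨_, (mem_locLattice_latticeOf_iff hL).1 hz, ?_⟩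
    rwa [h2, isom_apply_inv_self]
  · rintro ⟨z, hz, h⟩
    exact ⟨_, (h1 z).1 hz, by rwa [← h2]⟩

/-- A vector is primitive in a dual lattice if and only if it is primitive at every prime. -/
theorem isPrimitive_dual_iff {M : Submodule ℤ V} {x : V} : IsPrimitive (dual Q M) x ↔
    ∀ p, IsPadicPrimitive (locForm Q p) (locLattice M p) (toLoc p x) := by
  simp_rw [isPadicPrimitive_iff]
  have hcast : ∀ p : Nat.Primes, ((p : ℕ) : ℚ_[(p : ℕ)])⁻¹ • toLoc p x =
      toLoc p (((p : ℕ) : ℚ)⁻¹ • x) := fun p => by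
    rw [toLoc_smul, Rat.cast_inv, Rat.cast_natCast]
  refine ⟨fun h p => ⟨mem_dual_iff_forall_mem_padicDual.1 h.1 p, fun hp => ?_⟩, fun h =>
    ⟨mem_dual_iff_forall_mem_padicDual.2 fun p => (h p).1, fun n y hy hxy => ?_⟩⟩
  -- At primes q ≠ p division by p is harmless, so divisibility of x by p in the dual lattice is
  -- decided at p alone.
  · have h1 : ((p : ℕ) : ℚ)⁻¹ • x ∈ dual Q M := mem_dual_iff_forall_mem_padicDual.2 fun q => by
      by_cases hqp : q = p
      · subst hqp
        rwa [← hcast]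
      · rw [toLoc_smul, Rat.cast_inv, Rat.cast_natCast]
        exact padic_smul_mem (inv_mem_of_norm_eq_one (norm_natCast_eq_one fun h =>
          hqp (Subtype.ext ((Nat.prime_dvd_prime_iff_eq q.2 p.2).1 h))))
          (mem_dual_iff_forall_mem_padicDual.1 h.1 q)
    have h2 := h.2 (p : ℕ) _ h1 (by
      rw [natCast_zsmul, ← Nat.cast_smul_eq_nsmul ℚ, smul_smul,
        mul_inv_cancel₀ (Nat.cast_ne_zero.2 p.2.ne_zero), one_smul])
    rw [Int.isUnit_iff_natAbs_eq, Int.natAbs_natCast] at h2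
    exact p.2.ne_one h2
  · rw [Int.isUnit_iff_natAbs_eq]
    by_contra hn
    obtain ⟨q, hq, hqn⟩ := Nat.exists_prime_and_dvd hn
    obtain ⟨m, rfl⟩ := Int.natCast_dvd.2 hqn
    refine (h ⟨q, hq⟩).2 ?_
    rw [hcast ⟨q, hq⟩]
    refine mem_dual_iff_forall_mem_padicDual.1 ?_ _
    change ((q : ℕ) : ℚ)⁻¹ • x ∈ dual Q M
    have h1 : ((q : ℕ) : ℚ)⁻¹ • x = m • y := by
      rw [hxy, ← Int.cast_smul_eq_zsmul ℚ, smul_smul, ← Int.cast_smul_eq_zsmul ℚ, Int.cast_mul,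
        Int.cast_natCast, inv_mul_cancel_left₀ (Nat.cast_ne_zero.2 hq.ne_zero)]
    rw [h1]
    exact zsmul_mem hy m

theorem isPrimitive_dual_latticeOf_iff (hL : IsIntegralIn Q ⊤ L) {u : Adelic Q L} {x : V} :
    IsPrimitive (dual Q (latticeOf u)) x ↔
      ∀ p, IsPadicPrimitive (locForm Q p) (locLattice L p) (((u p)⁻¹).1 (toLoc p x)) := by
  rw [isPrimitive_dual_iff]
  exact forall_congr' fun p => isPadicPrimitive_latticeOf_iff hL

/-! ### Points of the stabilizer of ξ and primitive vectors -/

theorem mem_arithGroup_iff {u : Adelic Q L} {g : V ≃ₗ[ℚ] V} : g ∈ arithGroup u ↔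
    ∃ γ : orthogonal Q, γ.1 = g ∧ ∀ p, (u p)⁻¹ * locIsom Q p γ * u p ∈ K Q L p := by
  refine (Subgroup.mem_map).trans (exists_congr fun γ => and_comm.trans (and_congr Iff.rfl ?_))
  rw [Subgroup.mem_iInf]
  refine forall_congr' fun p => ?_
  rw [Subgroup.mem_comap, Subgroup.mem_map]
  constructor
  · rintro ⟨k, hk, h⟩
    rw [← h]
    simpa [mul_assoc] using hk
  · intro h
    exact ⟨_, h, by simp [mul_assoc]⟩

theorem locIsom_injective (p : Nat.Primes) : Function.Injective (locIsom Q p) := fun g h hgh => by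
  refine Subtype.ext (LinearEquiv.ext fun x => toLoc_injective (p := p) ?_)
  rw [← locIsom_toLoc, ← locIsom_toLoc, hgh]

/-- The relation between `h ∈ G^ξ(𝔸_f)` and `η ∈ V` that `h = γ u k` with `γ ∈ G(ℚ)`, `k ∈ K_f` and
`γ η = ξ`. -/
def Corresponds (u : Adelic Q L) (h : AdelicStab Q L ξ) (η : V) : Prop :=
  ∃ γ : orthogonal Q, ∃ k ∈ Kfin Q L, (∀ p, h.1 p = locIsom Q p γ * u p * k p) ∧ γ.1 η = ξ

variable {u : Adelic Q L} {h h' : AdelicStab Q L ξ} {η η' : V}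

theorem Corresponds.form_eq (hc : Corresponds u h η) : Q η = Q ξ := by
  obtain ⟨γ, -, -, -, rfl⟩ := hc
  exact (γ.2 η).symm

theorem Corresponds.isPrimitive (hL : IsIntegralIn Q ⊤ L) (hξ : IsPrimitive (dual Q L) ξ)
    (hc : Corresponds u h η) : IsPrimitive (dual Q (latticeOf u)) η := by
  obtain ⟨γ, k, hk, hh, hγ⟩ := hc
  refine (isPrimitive_dual_latticeOf_iff hL).2 fun p => ?_
  have h1 : ((u p)⁻¹).1 (toLoc p η) = (k p).1 (toLoc p ξ) := by
    have h2 : (h.1 p).1 (toLoc p ξ) = (locIsom Q p γ).1 (toLoc p η) := by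
      rw [locIsom_toLoc, hγ]
      exact h.2 p
    rw [hh, isom_mul_apply, isom_mul_apply] at h2
    rw [← (locIsom Q p γ).1.injective h2, isom_inv_apply_self]
  rw [h1]
  exact (isPrimitive_dual_iff.1 hξ p).isom (hk p)

/-- For δ ∈ Γ(u), γ u k = (γ δ⁻¹) u (u⁻¹ δ u k), and u⁻¹ δ u lies in K_f. -/
theorem Corresponds.arithGroup_smul (hc : Corresponds u h η) {g : V ≃ₗ[ℚ] V}
    (hg : g ∈ arithGroup u) : Corresponds u h (g η) := by
  obtain ⟨γ, k, hk, hh, hγ⟩ := hc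
  obtain ⟨δ, rfl, hδ⟩ := mem_arithGroup_iff.1 hg
  refine ⟨γ * δ⁻¹, ⟨fun p => ((u p)⁻¹ * locIsom Q p δ * u p) * k p, ?_⟩, fun p =>
    mul_mem (hδ p) (hk p), fun p => ?_, ?_⟩
  · exact Filter.Eventually.of_forall fun p => mul_mem (hδ p) (hk p)
  · rw [hh, map_mul, map_inv]
    change _ = _ * ((u p)⁻¹ * locIsom Q p δ * u p * k p)
    group
  · rw [isom_mul_apply, isom_inv_apply_self, hγ]

/-- From γ u k = γ' u k' it follows that γ'⁻¹γ = u k' k⁻¹ u⁻¹, which is in Γ(u) and takes η to η'.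
-/
theorem Corresponds.mem_orbit (hc : Corresponds u h η) (hc' : Corresponds u h η') :
    ∃ g ∈ arithGroup u, g η = η' := by
  obtain ⟨γ, k, hk, hh, hγ⟩ := hc
  obtain ⟨γ', k', hk', hh', hγ'⟩ := hc'
  refine ⟨(γ'⁻¹ * γ).1, mem_arithGroup_iff.2 ⟨_, rfl, fun p => ?_⟩, ?_⟩
  · have h1 : (u p)⁻¹ * locIsom Q p (γ'⁻¹ * γ) * u p = k' p * (k p)⁻¹ := by
      have h2 := (hh p).symm.trans (hh' p)
      rw [map_mul, map_inv, eq_mul_inv_iff_mul_eq]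
      calc _ = (u p)⁻¹ * (locIsom Q p γ')⁻¹ * (locIsom Q p γ * u p * k p) := by group
        _ = _ := by rw [h2]; group
    rw [h1]
    exact mul_mem (hk' p) (inv_mem (hk p))
  · rw [isom_mul_apply, hγ, ← hγ', isom_inv_apply_self]

theorem mem_rationalStab_iff {x : AdelicStab Q L ξ} :
    x ∈ rationalStab Q L ξ ↔ ∃ δ : orthogonal Q, δ.1 ξ = ξ ∧ ∀ p, x.1 p = locIsom Q p δ := by
  refine ⟨fun ⟨δ, hδ⟩ => ⟨δ, ?_, hδ⟩, fun ⟨δ, _, hδ⟩ => ⟨δ, hδ⟩⟩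
  have h1 : ∀ p, toLoc p (δ.1 ξ) = toLoc p ξ := fun p => by
    rw [← locIsom_toLoc, ← hδ]
    exact x.2 p
  exact toLoc_injective (h1 ⟨2, Nat.prime_two⟩)

theorem Corresponds.mul_mul (hKp : KPerpStarFin Q L ξ ≤ (Kfin Q L).subgroupOf (AdelicStab Q L ξ))
    (hc : Corresponds u h η) {δ κ : AdelicStab Q L ξ} (hδ : δ ∈ rationalStab Q L ξ)
    (hκ : κ ∈ KPerpStarFin Q L ξ) : Corresponds u (δ * h * κ) η := by
  obtain ⟨γ, k, hk, hh, hγ⟩ := hc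
  obtain ⟨d, hd, hdp⟩ := mem_rationalStab_iff.1 hδ
  refine ⟨d * γ, k * κ.1, mul_mem hk (hKp hκ), fun p => ?_, ?_⟩
  · change δ.1 p * h.1 p * κ.1 p = locIsom Q p (d * γ) * u p * (k p * κ.1 p)
    rw [hdp, hh, map_mul]
    group
  · rw [isom_mul_apply, hγ, hd]

theorem exists_rationalStab (hL : IsIntegralIn Q ⊤ L) {δ : orthogonal Q} (hδ : δ.1 ξ = ξ) :
    ∃ x : AdelicStab Q L ξ, x ∈ rationalStab Q L ξ ∧ ∀ p, x.1 p = locIsom Q p δ := by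
  obtain ⟨g, hg, hgp⟩ := exists_rationalPoint hL.1 hL.2.1 δ
  refine ⟨⟨g, fun p => ?_⟩, hg, hgp⟩
  change (g p).1 (toLoc p ξ) = toLoc p ξ
  rw [hgp, locIsom_toLoc, hδ]

/-- The rational isometry δ = γ' γ⁻¹ fixes ξ, and (δ h)⁻¹ h' = k⁻¹ k' lies in K_f. -/
theorem Corresponds.eq_mul_mul (hL : IsIntegralIn Q ⊤ L)
    (hKp : (Kfin Q L).subgroupOf (AdelicStab Q L ξ) ≤ KPerpStarFin Q L ξ)
    (hc : Corresponds u h η) (hc' : Corresponds u h' η) :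
    ∃ δ ∈ rationalStab Q L ξ, ∃ κ ∈ KPerpStarFin Q L ξ, h' = δ * h * κ := by
  obtain ⟨γ, k, hk, hh, hγ⟩ := hc
  obtain ⟨γ', k', hk', hh', hγ'⟩ := hc'
  have hδ : (γ' * γ⁻¹).1 ξ = ξ := by rw [isom_mul_apply, ← hγ, isom_inv_apply_self, hγ', hγ]
  obtain ⟨x, hx, hxp⟩ := exists_rationalStab hL hδ
  refine ⟨x, hx, (x * h)⁻¹ * h', hKp fun p => ?_, by group⟩
  change (x.1 p * h.1 p)⁻¹ * h'.1 p ∈ K Q L p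
  have h1 : (x.1 p * h.1 p)⁻¹ * h'.1 p = (k p)⁻¹ * k' p := by
    rw [hxp, hh, hh', map_mul, map_inv]
    group
  rw [h1]
  exact mul_mem (inv_mem (hk p)) (hk' p)

/-- A vector of the same norm as `ξ` that is locally equivalent to `ξ` corresponds to a point of the
stabilizer of `ξ`. -/
theorem exists_corresponds (hL : IsIntegralIn Q ⊤ L) (h0 : Q ξ ≠ 0) (hη : Q η = Q ξ)
    (hloc : ∀ p, ∃ k ∈ K Q L p, k.1 (toLoc p ξ) = ((u p)⁻¹).1 (toLoc p η)) :
    ∃ h : AdelicStab Q L ξ, Corresponds u h η := by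
  obtain ⟨γ, hγ⟩ := exists_isom_apply_eq hη (hη ▸ h0)
  choose k hk hkξ using hloc
  obtain ⟨g, -, hg⟩ := exists_rationalPoint hL.1 hL.2.1 γ
  let k' : Adelic Q L := ⟨k, Filter.Eventually.of_forall hk⟩
  refine ⟨⟨g * u * k', fun p => ?_⟩, γ, k', hk, fun p => ?_, hγ⟩
  · change (g p * u p * k p).1 (toLoc p ξ) = toLoc p ξ
    rw [isom_mul_apply, isom_mul_apply, hkξ, isom_apply_inv_self, hg, locIsom_toLoc, hγ]
  · rw [← hg]
    rfl

end Adelic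

/-! ### Comparison of stabilizers and local transitivity -/

section Main

variable {V : Type*} [AddCommGroup V] [Module ℚ V] {Q : QuadraticForm ℚ V} {L : Submodule ℤ V}
  {ξ : V}

/-- Two sets that are parametrized by subsets of one set `D`, which correspond to each other under a
permutation of `D`, have the same cardinality. -/
theorem nonempty_equiv_of_param {α β D σ τ : Type*} [SetLike σ α] [SetLike τ β] {S : σ} {T : τ}
    {P P' : D → Prop} (φ : D ≃ D) (hφ : ∀ d, P' (φ d) ↔ P d) {r : α → D → Prop} {i : D → β}
    (hS : ∀ a, a ∈ S ↔ ∃ d, P d ∧ r a d) (hT : ∀ b, b ∈ T ↔ ∃ d, P' d ∧ i d = b)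
    (hi : Function.Injective i) (hex : ∀ d, P d → ∃ a, r a d)
    (hr : ∀ {a d d'}, r a d → r a d' → d = d') (hr' : ∀ {a a' d}, r a d → r a' d → a = a') :
    Nonempty (S ≃ T) := by
  choose f hfP hf using fun a : S => (hS a.1).1 a.2
  refine ⟨Equiv.ofBijective (fun a => ⟨i (φ (f a)), (hT _).2 ⟨_, (hφ _).2 (hfP a), rfl⟩⟩)
    ⟨fun a a' h => ?_, fun b => ?_⟩⟩
  · have h1 : f a = f a' := φ.injective (hi (congrArg Subtype.val h))
    exact Subtype.ext (hr' (hf a) (h1 ▸ hf a'))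
  · obtain ⟨d, hd, hb⟩ := (hT b.1).1 b.2
    have hd' : P (φ.symm d) := by rwa [← hφ, φ.apply_symm_apply]
    obtain ⟨a, ha⟩ := hex _ hd'
    refine ⟨⟨a, (hS a).2 ⟨_, hd', ha⟩⟩, Subtype.ext ?_⟩
    change i (φ _) = b.1
    rw [hr (hf _) ha, φ.apply_symm_apply, hb]

theorem mem_map_conj_iff {G : Type*} [Group G] {H : Subgroup G} {x h : G} :
    x ∈ Subgroup.map (MulAut.conj h).toMonoidHom H ↔ h⁻¹ * x * h ∈ H := by
  rw [Subgroup.mem_map]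
  constructor
  · rintro ⟨κ, hκ, rfl⟩
    simpa [mul_assoc] using hκ
  · intro hx
    exact ⟨_, hx, by simp [mul_assoc]⟩

theorem mem_map_conj_KPerpStarFin_iff
    (hKp : KPerpStarFin Q L ξ = (Kfin Q L).subgroupOf (AdelicStab Q L ξ))
    {h x : AdelicStab Q L ξ} {δ : orthogonal Q} (hx : ∀ p, x.1 p = locIsom Q p δ) :
    x ∈ Subgroup.map (MulAut.conj h).toMonoidHom (KPerpStarFin Q L ξ) ↔
      ∀ p, (h.1 p)⁻¹ * locIsom Q p δ * h.1 p ∈ K Q L p := by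
  rw [mem_map_conj_iff, hKp]
  refine forall_congr' fun p => ?_
  rw [← hx]
  rfl

theorem conj_mem_K_iff {u h k : Adelic Q L} {γ : orthogonal Q} (hk : k ∈ Kfin Q L)
    (hh : ∀ p, h p = locIsom Q p γ * u p * k p) (p : Nat.Primes) (δ : orthogonal Q) :
    (u p)⁻¹ * locIsom Q p (γ⁻¹ * δ * γ) * u p ∈ K Q L p ↔
      (h p)⁻¹ * locIsom Q p δ * h p ∈ K Q L p := by
  have h1 : (u p)⁻¹ * locIsom Q p (γ⁻¹ * δ * γ) * u p =
      k p * ((h p)⁻¹ * locIsom Q p δ * h p) * (k p)⁻¹ := by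
    rw [hh, map_mul, map_mul, map_inv]
    group
  rw [h1, Subgroup.mul_mem_cancel_right _ (inv_mem (hk p)),
    Subgroup.mul_mem_cancel_left _ (hk p)]

theorem mem_rationalStab_inf_iff
    (hKp : KPerpStarFin Q L ξ = (Kfin Q L).subgroupOf (AdelicStab Q L ξ))
    {h x : AdelicStab Q L ξ} :
    x ∈ rationalStab Q L ξ ⊓ Subgroup.map (MulAut.conj h).toMonoidHom (KPerpStarFin Q L ξ) ↔
      ∃ δ : orthogonal Q, (δ.1 ξ = ξ ∧ ∀ p, (h.1 p)⁻¹ * locIsom Q p δ * h.1 p ∈ K Q L p) ∧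
        ∀ p, x.1 p = locIsom Q p δ := by
  rw [Subgroup.mem_inf, mem_rationalStab_iff, ← exists_and_right]
  refine exists_congr fun δ => ?_
  rw [and_assoc, and_assoc, and_comm (a := ∀ p, x.1 p = _)]
  refine and_congr_right fun _ => and_congr_left fun hx => mem_map_conj_KPerpStarFin_iff hKp hx

theorem mem_arithGroup_inf_iff {u : Adelic Q L} {η : V} {g : V ≃ₗ[ℚ] V} :
    g ∈ arithGroup u ⊓ fixing (A := ℚ) η ↔ ∃ γ : orthogonal Q,
      (γ.1 η = η ∧ ∀ p, (u p)⁻¹ * locIsom Q p γ * u p ∈ K Q L p) ∧ γ.1 = g := by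
  rw [Subgroup.mem_inf, mem_arithGroup_iff, ← exists_and_right]
  refine exists_congr fun γ => ?_
  constructor
  · rintro ⟨⟨rfl, h1⟩, h2⟩
    exact ⟨⟨h2, h1⟩, rfl⟩
  · rintro ⟨⟨h2, h1⟩, rfl⟩
    exact ⟨⟨rfl, h1⟩, h2⟩

/-- Both groups are parametrized by rational isometries: those δ fixing ξ with h⁻¹ δ h ∈ K_f, and
those fixing η with the same condition for u. Since h = γ u k and γη = ξ, δ ↦ γ⁻¹ δ γ exchanges the
two conditions. -/
theorem Corresponds.mk_eq (hL : IsIntegralIn Q ⊤ L)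
    (hKp : KPerpStarFin Q L ξ = (Kfin Q L).subgroupOf (AdelicStab Q L ξ)) {u : Adelic Q L}
    {h : AdelicStab Q L ξ} {η : V} (hc : Corresponds u h η) :
    Cardinal.mk ↥(rationalStab Q L ξ ⊓
        Subgroup.map (MulAut.conj h).toMonoidHom (KPerpStarFin Q L ξ)) =
      Cardinal.mk ↥(arithGroup u ⊓ fixing (A := ℚ) η) := by
  obtain ⟨γ, k, hk, hh, hγ⟩ := hc
  have hφ : ∀ δ, (MulAut.conj γ⁻¹).toEquiv δ = γ⁻¹ * δ * γ := fun δ => by simp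
  have hfix : ∀ δ : orthogonal Q, (γ⁻¹ * δ * γ).1 η = η ↔ δ.1 ξ = ξ := fun δ => by
    rw [isom_mul_apply, isom_mul_apply, hγ, ← γ.1.injective.eq_iff, isom_apply_inv_self, hγ]
  refine Cardinal.eq.2 (nonempty_equiv_of_param (MulAut.conj γ⁻¹).toEquiv (fun δ => ?_)
    (fun x => mem_rationalStab_inf_iff hKp) (fun g => mem_arithGroup_inf_iff)
    Subtype.val_injective (fun δ hδ => (exists_rationalStab hL hδ.1).imp fun _ => And.right)
    (fun hδ hδ' => locIsom_injective ⟨2, Nat.prime_two⟩ ((hδ _).symm.trans (hδ' _)))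
    (fun hx hx' => Subtype.ext (DFunLike.ext _ _ fun p => (hx p).trans (hx' p).symm)))
  rw [hφ]
  exact and_congr (hfix δ) (forall_congr' fun p => conj_mem_K_iff hk hh p δ)

theorem mem_K_iff {p : Nat.Primes} {g : orthogonal (locForm Q p)} :
    g ∈ K Q L p ↔ g.1 ∈ preserving (locLattice L p) := Iff.rfl

theorem KPerpStarFin_eq (hnd : (QuadraticMap.associated Q).Nondegenerate)
    (hL : IsIntegralIn Q ⊤ L) (hK : ∀ p, K Q L p = KStar Q L p) (hξ : IsReduced Q L ξ) :
    KPerpStarFin Q L ξ = (Kfin Q L).subgroupOf (AdelicStab Q L ξ) := by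
  obtain ⟨w, hw, hξw⟩ := hξ.1.exists_pairing_eq_one hnd hL.2.1
  refine le_antisymm (fun κ hκ p => KPerpStar_le hL (hξ.form_ne_zero hnd hL) (hκ p))
    fun κ hκ p => mem_KPerpStar_of_mem_KStar hw hξw hξ.1.1 (hK p ▸ hκ p) (κ.2 p)

theorem exists_mem_K_apply_eq (hnd : (QuadraticMap.associated Q).Nondegenerate)
    (hiso : ∃ v : V, v ≠ 0 ∧ Q v = 0) (hL : IsMaximalIn Q ⊤ L) {p : Nat.Primes}
    (hK : K Q L p = KStar Q L p) {x y : Loc V p}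
    (hx : IsPadicPrimitive (locForm Q p) (locLattice L p) x)
    (hy : IsPadicPrimitive (locForm Q p) (locLattice L p) y) (hxy : locForm Q p x = locForm Q p y) :
    ∃ k ∈ K Q L p, k.1 x = y := by
  obtain ⟨e, he, f, hf, hQe, hQf, hef⟩ := hL.exists_hyperbolic_pair hnd hiso
  refine exists_isom_of_primitive (fun x hx => form_mem_subring hL.1 hx)
    (fun x hx hQ => hL.mem_locLattice hnd hx hQ) (fun g hg x hx => ?_)
    (toLoc_mem he) (toLoc_mem hf) (by rw [locForm_toLoc, hQe, Rat.cast_zero])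
    (by rw [locForm_toLoc, hQf, Rat.cast_zero]) (by rw [assoc_toLoc, hef, Rat.cast_one]) hx hy hxy
  have h1 : g ∈ KStar Q L p := hK ▸ (mem_K_iff.2 hg)
  exact h1.2 x (padicDual_le_locLattice_dual hnd hL.1 hx)

theorem orbitOf_eq_iff {u : Adelic Q L} {Δ : ℚ} {η η' : primVectors u Δ} :
    orbitOf η = orbitOf η' ↔ ∃ g ∈ arithGroup u, g η'.1 = η.1 := by
  refine Quotient.eq.trans ?_
  change η.1 ∈ MulAction.orbit (arithGroup u) η'.1 ↔ _
  constructor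
  · rintro ⟨g, hg⟩
    exact ⟨g.1, g.2, hg⟩
  · rintro ⟨g, hg, h⟩
    exact ⟨⟨g, hg⟩, h⟩

end Main

end QuadLattice

/-! ### The bijection -/

theorem proposition2p1 {V : Type*} [AddCommGroup V] [Module ℚ V] [FiniteDimensional ℚ V]
    (Q : QuadraticForm ℚ V)
    (hnondeg : (QuadraticMap.associated Q).Nondegenerate)
    (hiso : ∃ v : V, v ≠ 0 ∧ Q v = 0)
    (L : Submodule ℤ V) (hL : IsMaximalIn Q ⊤ L)
    (hK : ∀ p, K Q L p = KStar Q L p)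
    (ξ : V) (hξ : IsReduced Q L ξ)
    {J : Type*} (u : J → Adelic Q L)
    (hu : ∀ g : Adelic Q L, ∃! j, ∃ γ ∈ rationalPoints Q L, ∃ k ∈ Kfin Q L, g = γ * u j * k) :
    ∃ f : DoubleCoset.Quotient (rationalStab Q L ξ : Set (AdelicStab Q L ξ))
          (KPerpStarFin Q L ξ : Set (AdelicStab Q L ξ)) →
        Σ j : J, PrimOrbits (u j) (Q ξ),
      Function.Bijective f ∧
      ∀ (h : AdelicStab Q L ξ) (j : J) (η : primVectors (u j) (Q ξ)),
        f (DoubleCoset.mk (rationalStab Q L ξ) (KPerpStarFin Q L ξ) h) = ⟨j, orbitOf η⟩ →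
        Cardinal.mk ↥(rationalStab Q L ξ ⊓
            Subgroup.map (MulAut.conj h).toMonoidHom (KPerpStarFin Q L ξ)) =
          Cardinal.mk ↥(arithGroup (u j) ⊓ fixing (A := ℚ) η.val) := by
  have h0 := hξ.form_ne_zero hnondeg hL.1
  have hKp := KPerpStarFin_eq hnondeg hL.1 hK hξ
  have hex : ∀ h : AdelicStab Q L ξ, ∃ (j : J) (η : primVectors (u j) (Q ξ)),
      Corresponds (u j) h η.1 := fun h => by
    obtain ⟨j, ⟨γ, ⟨δ, hδ⟩, k, hk, hh⟩, -⟩ := hu h.1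
    have hc : Corresponds (u j) h ((δ⁻¹).1 ξ) :=
      ⟨δ, k, hk, fun p => by rw [← hδ, hh]; rfl, isom_apply_inv_self δ ξ⟩
    exact ⟨j, ⟨_, hc.isPrimitive hL.1 hξ.1, hc.form_eq⟩, hc⟩
  -- Correspondence places h in the double coset of u_j, and these double cosets are disjoint.
  have huniq : ∀ {h : AdelicStab Q L ξ} {j j' : J} {η η' : V}, Corresponds (u j) h η →
      Corresponds (u j') h η' → j = j' := fun {h j j' η η'} hc hc' => by
    have key : ∀ {j η}, Corresponds (u j) h η →
        ∃ γ ∈ rationalPoints Q L, ∃ k ∈ Kfin Q L, h.1 = γ * u j * k := by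
      rintro j η ⟨γ, k, hk, hh, -⟩
      obtain ⟨g, hg, hgp⟩ := exists_rationalPoint hL.1.1 hL.1.2.1 γ
      refine ⟨g, hg, k, hk, DFunLike.ext _ _ fun p => ?_⟩
      rw [hh, ← hgp]
      rfl
    exact (hu h.1).unique (key hc) (key hc')
  choose j₀ η₀ hc₀ using hex
  let f : DoubleCoset.Quotient (rationalStab Q L ξ : Set (AdelicStab Q L ξ))
      (KPerpStarFin Q L ξ : Set (AdelicStab Q L ξ)) → Σ j : J, PrimOrbits (u j) (Q ξ) :=
    fun q => ⟨j₀ q.out, orbitOf (η₀ q.out)⟩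
  -- This makes the map independent of the chosen representatives and vectors; bijectivity and the
  -- equality of cardinalities then become statements about `Corresponds`.
  have hf : ∀ (h : AdelicStab Q L ξ) (j : J) (η : primVectors (u j) (Q ξ)),
      f (DoubleCoset.mk _ _ h) = ⟨j, orbitOf η⟩ ↔ Corresponds (u j) h η.1 := by
    intro h j η
    set h' := (DoubleCoset.mk (rationalStab Q L ξ) (KPerpStarFin Q L ξ) h).out with hh'
    obtain ⟨δ, hδ, κ, hκ, hδκ⟩ := (DoubleCoset.eq _ _ h' h).1 (Quotient.out_eq _)
    have hiff : Corresponds (u j) h η.1 ↔ Corresponds (u j) h' η.1 := by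
      refine ⟨fun hc => ?_, fun hc => hδκ ▸ hc.mul_mul hKp.le hδ hκ⟩
      have h1 := hc.mul_mul hKp.le (inv_mem hδ) (inv_mem hκ)
      rwa [hδκ, show δ⁻¹ * (δ * h' * κ) * κ⁻¹ = h' by group] at h1
    rw [hiff]
    change (⟨j₀ h', orbitOf (η₀ h')⟩ : Σ j : J, PrimOrbits (u j) (Q ξ)) = ⟨j, orbitOf η⟩ ↔ _
    have hc := hc₀ h'
    generalize j₀ h' = i, η₀ h' = θ at hc
    constructor
    · intro heq
      obtain ⟨rfl, heq⟩ := Sigma.mk.inj_iff.1 heq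
      obtain ⟨g, hg, hgθ⟩ := orbitOf_eq_iff.1 (eq_of_heq heq).symm
      exact hgθ ▸ hc.arithGroup_smul hg
    · intro hc'
      obtain rfl := huniq hc hc'
      exact congrArg (Sigma.mk i) (orbitOf_eq_iff.2 (hc'.mem_orbit hc))
  have hrep : ∀ s : Σ j : J, PrimOrbits (u j) (Q ξ), ∃ (j : J) (η : primVectors (u j) (Q ξ)),
      s = ⟨j, orbitOf η⟩ := by
    rintro ⟨j, s⟩
    obtain ⟨η, rfl⟩ := Quotient.exists_rep s
    exact ⟨j, η, rfl⟩
  refine ⟨f, ⟨fun q q' hqq' => ?_, fun s => ?_⟩, fun h j η hfh =>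
    ((hf h j η).1 hfh).mk_eq hL.1 hKp⟩
  · obtain ⟨h, rfl⟩ := Quotient.exists_rep q
    obtain ⟨h', rfl⟩ := Quotient.exists_rep q'
    obtain ⟨j, η, hjη⟩ := hrep (f (DoubleCoset.mk _ _ h))
    exact (DoubleCoset.eq _ _ h h').2 (((hf h j η).1 hjη).eq_mul_mul hL.1 hKp.ge
      ((hf h' j η).1 (hqq'.symm.trans hjη)))
  · obtain ⟨j, η, rfl⟩ := hrep s
    obtain ⟨h, hc⟩ := exists_corresponds (u := u j) hL.1 h0 η.2.2 fun p =>
      exists_mem_K_apply_eq hnondeg hiso hL (hK p) (isPrimitive_dual_iff.1 hξ.1 p)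
        ((isPrimitive_dual_latticeOf_iff hL.1).1 η.2.1 p)
        (by rw [((u j p)⁻¹).2, locForm_toLoc, locForm_toLoc, η.2.2])
    exact ⟨_, (hf h j η).2 hc⟩
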